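/- Theorem 2. Let $h$ be a complex-valued function that is analytic on a neighbourhood of the half-line $[0,\infty)$ in $\mathbb{C}$, and let $\bar h$ be a function on the closed half-plane $H(\delta)=\{s\in\mathbb{C}:\operatorname{Re}s\ge-\delta\}$, where $1/8<\delta<1/2$. Suppose that (1) near $z=0$ the function $h$ has the Taylor series $h(z)=\sum_{m=0}^\infty \frac{\bar h(m)}{m!}(-z)^m$, so that $\bar h(m)=(-1)^m h^{(m)}(0)$ for $m=0,1,2,\dots$; (2) $h(x)=O(x^{-d})$ as $x\to+\infty$ along the real axis, for some $d>1/8$; (3) $\bar h$ (written $\bar h^{(s)}(0)$ when regarded as an interpolation of the signed derivatives) is complex differentiable on $H(\delta)$, and there are real constants $C$, $P$ and $A<\pi/2$ with $|\bar h(v+iw)|<C\,e^{Pv+A|w|}$ for all $v+iw\in H(\delta)$. Let $q>0$ and $f(x)=h(x^4)$, and let $J_0$ be the Bessel function of the first kind of order zero. Then the improper integral $\int_0^\infty J_0(qx)f(x)\,x\,dx=\lim_{R\to\infty}\int_0^R J_0(qx)f(x)\,x\,dx$ converges, and for every real $\alpha$ with $-\delta\le\alpha<0$ $$\int_0^\infty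 J_0(qx)\,f(x)\,x\,dx=\frac{1}{q^2\sqrt{\pi}\,i}\int_{\alpha-i\infty}^{\alpha+i\infty}\bar h(s)\,\frac{\Gamma(2s+1)}{\Gamma(1/2-s)}\,2^{6s+1}q^{-4s}\,ds ,$$ where the contour integral converges absolutely. -/

import Mathlib

open Filter Topology MeasureTheory
open scoped Nat

/-- The Bessel function of the first kind of order zero, given by its (everywhere convergent)
power series `J₀(x) = ∑ (-1)^m / (m!)² (x/2)^(2m)`. -/
noncomputable def besselJ0 (x : ℝ) : ℝ :=
  ∑' m : ℕ, (-1 : ℝ) ^ m / ((m ! : ℝ) ^ 2) * (x / 2) ^ (2 * m)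

/-- The contour integral of `F` along the vertical line `Re s = α`, traversed from `α - i∞` to
`α + i∞`. With `s = α + i w` one has `ds = i dw`. -/
noncomputable def verticalIntegral (α : ℝ) (F : ℂ → ℂ) : ℂ :=
  Complex.I * ∫ w : ℝ, F ((α : ℂ) + (w : ℂ) * Complex.I)

/-- The contour integral of `F` along the line `Re s = α` converges absolutely. -/
def VerticalIntegrable (α : ℝ) (F : ℂ → ℂ) : Prop :=
  Integrable (fun w : ℝ => F ((α : ℂ) + (w : ℂ) * Complex.I))

/-- The Hankel transform of order zero of `f` at `q`, the improper Riemann integral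
`∫₀^∞ J₀(q x) f(x) x dx = lim_{R → ∞} ∫₀^R J₀(q x) f(x) x dx`, converges and has the value `A`.
The integral need not converge absolutely. -/
def HasHankelTransform (f : ℝ → ℂ) (q : ℝ) (A : ℂ) : Prop :=
  (∀ R : ℝ, 0 ≤ R →
      IntervalIntegrable (fun x : ℝ => (besselJ0 (q * x) : ℂ) * f x * (x : ℂ)) volume 0 R) ∧
    Tendsto (fun R : ℝ => ∫ x in (0 : ℝ)..R, (besselJ0 (q * x) : ℂ) * f x * (x : ℂ))
      atTop (𝓝 A)

/-- The integrand `h̄(s) Γ(2s+1) / Γ(1/2-s) 2^(6s+1) q^(-4s)` of the inverse Mellin integral. -/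
noncomputable def hankelMellinIntegrand (hbar : ℂ → ℂ) (q : ℝ) (s : ℂ) : ℂ :=
  hbar s * (Complex.Gamma (2 * s + 1) / Complex.Gamma (1 / 2 - s)) *
    (2 : ℂ) ^ (6 * s + 1) * (q : ℂ) ^ (-4 * s)

/-!
The proof composes two Mellin integrals on the line `Re s = -δ`.

*Mellin–Barnes integral of `h`.* For all `x > 0`,
`2π h(x) = ∫ Γ(-s) hbar(s) x^s dw` with `s = -δ + iw` (`integral_Gamma_mul_cpow_eq`, Ramanujan's
master theorem). The line is moved to the right over the poles of `Γ(-s)` at `0, 1, 2, …`; their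
residues are the terms of the Taylor series of `h`. The growth condition on `hbar` makes this series
entire, so that it represents `h` on the whole half-line by the identity theorem. Instead of moving
the line, one keeps it fixed and changes `hbar`: crossing one pole and translating back by one
replaces `F` by `gammaShift F`, `s ↦ -F(s + 1) / (s + 1)`. After `N` steps the denominators have
grown like a factorial, so the remainder tends to `0`. Stirling's formula is not needed: the
Beta integral shows that `|Γ(σ + iw)| / Γ(σ)` increases with `σ`, which allows a comparison with the
line `σ = 1/2`, where `|Γ|² = π / cosh (πw)` by reflection.

*Mellin transform of `J₀`.* For `-1/2 < Re s < -1/8` the integral `∫ J₀(qx) x^(4s) x dx` converges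
conditionally (`tendsto_hankelKernel`). As `(x J₁)' = x J₀`, an integration by parts turns it into
an absolutely convergent integral of `J₁(qx) x^(4s)`, because `√x J₁(x)` is bounded
(`exists_mul_sq_besselJ1_le`); the bound it gives for the truncated integrals is uniform in `R` and
linear in `|s|`. The Mellin transform of `J₁` follows from Weber's integral
`∫ J₁(x) x² e^(-p x²) dx = e^(-1/(4p)) / (4p²)` upon integrating against `p^(-2s)`
(`Gamma_mul_integral_cpow_mul_besselJ1`).

For finite `R` the Mellin–Barnes integral is inserted into the Hankel transform and Fubini's theorem
applies; dominated convergence then gives the limit `R → ∞`, and Legendre's duplication formula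
puts the result into its final form. Since `hankelMellinIntegrand` is regular
for `Re s ≥ -δ` (the poles of `Γ(2s + 1)` have `Re s ≤ -1/2`) and decays exponentially on the strip
`-δ ≤ Re s ≤ α`, the line may finally be moved from `-δ` to `α`.
-/

/-! ### Bessel functions of orders zero and one -/

/-- An everywhere absolutely convergent real power series may be differentiated term by term. -/
lemma hasDerivAt_tsum_mul_pow {a : ℕ → ℝ} (ha : ∀ r : ℝ, 1 ≤ r → Summable fun n => |a n| * r ^ n)
    (t : ℝ) :
    HasDerivAt (fun t => ∑' n, a n * t ^ n) (∑' n : ℕ, ((n : ℝ) + 1) * a (n + 1) * t ^ n) t := by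
  set r : ℝ := |t| + 1 with hr
  have hr1 : 1 ≤ r := by simp [hr]
  have hu : Summable fun n : ℕ => |a n| * (2 * r) ^ n := ha _ (by linarith)
  have hbd : ∀ (n : ℕ) (y : ℝ), y ∈ Metric.ball (0 : ℝ) r →
      ‖a n * ((n : ℝ) * y ^ (n - 1))‖ ≤ |a n| * (2 * r) ^ n := by
    intro n y hy
    have hy' : |y| ≤ r := by simpa using (Metric.mem_ball.1 hy).le
    rw [norm_mul, norm_mul, norm_pow, Real.norm_eq_abs, Real.norm_eq_abs, Real.norm_eq_abs, mul_pow]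
    have h1 : |(n : ℝ)| ≤ 2 ^ n := by
      rw [abs_of_nonneg (by positivity)]
      exact_mod_cast Nat.lt_two_pow_self.le
    have h2 : |y| ^ (n - 1) ≤ r ^ n :=
      (pow_le_pow_left₀ (abs_nonneg _) hy' _).trans (pow_le_pow_right₀ hr1 (Nat.sub_le _ _))
    gcongr
  have key := hasDerivAt_tsum_of_isPreconnected (𝕜 := ℝ) (g := fun n y => a n * y ^ n)
    (g' := fun n y => a n * ((n : ℝ) * y ^ (n - 1))) hu Metric.isOpen_ball
    (convex_ball (0 : ℝ) r).isPreconnected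
    (fun n y _ => (hasDerivAt_pow n y).const_mul (a n)) hbd
    (y₀ := 0) (by simp; linarith) (by
      refine Summable.of_norm_bounded hu fun n => ?_
      rw [norm_mul, norm_pow]
      have : ‖(0 : ℝ)‖ ^ n ≤ (2 * r) ^ n := pow_le_pow_left₀ (by simp) (by simp; linarith) _
      simpa using mul_le_mul_of_nonneg_left this (abs_nonneg (a n)))
    (y := t) (by simp [hr])
  refine key.congr_deriv ?_
  have hs : Summable fun n : ℕ => a n * ((n : ℝ) * t ^ (n - 1)) :=
    Summable.of_norm_bounded hu fun n => hbd n t (by simp [hr])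
  rw [hs.tsum_eq_zero_add]
  simp only [Nat.cast_zero, zero_mul, mul_zero, zero_add]
  refine tsum_congr fun n => ?_
  rw [Nat.add_sub_cancel]
  push_cast
  ring

/-- The Bessel function of the first kind of order one, by its power series. -/
noncomputable def besselJ1 (x : ℝ) : ℝ :=
  ∑' m : ℕ, (-1 : ℝ) ^ m / ((m ! : ℝ) * ((m + 1)! : ℝ)) * (x / 2) ^ (2 * m + 1)

lemma summable_bessel_coeff (r : ℝ) (hr : 1 ≤ r) :
    Summable fun n : ℕ => |(-1 : ℝ) ^ n / ((n ! : ℝ) ^ 2)| * r ^ n := by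
  refine Summable.of_nonneg_of_le (fun n => by positivity) (fun n => ?_)
    (Real.summable_pow_div_factorial r)
  have h1 : (1 : ℝ) ≤ n ! := by exact_mod_cast Nat.factorial_pos n
  rw [abs_div, abs_pow, abs_neg, abs_one, one_pow, abs_of_nonneg (by positivity), one_div,
    ← div_eq_inv_mul]
  gcongr
  nlinarith

lemma summable_mul_bessel_coeff (r : ℝ) (hr : 1 ≤ r) :
    Summable fun n : ℕ => |(n : ℝ) * ((-1 : ℝ) ^ n / ((n ! : ℝ) ^ 2))| * r ^ n := by
  refine Summable.of_nonneg_of_le (fun n => by positivity) (fun n => ?_)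
    (Real.summable_pow_div_factorial r)
  have h1 : (0 : ℝ) < n ! := by exact_mod_cast Nat.factorial_pos n
  have h2 : (n : ℝ) ≤ n ! := by exact_mod_cast Nat.self_le_factorial n
  rw [abs_mul, abs_div, abs_pow, abs_neg, abs_one, one_pow, abs_of_nonneg (by positivity),
    abs_of_nonneg (by positivity), mul_one_div, div_mul_eq_mul_div, sq, div_le_div_iff₀
    (by positivity) h1]
  nlinarith [mul_le_mul_of_nonneg_right h2 (show 0 ≤ r ^ n * (n ! : ℝ) by positivity)]

lemma besselJ0_eq (x : ℝ) :
    besselJ0 x = ∑' n : ℕ, (-1 : ℝ) ^ n / ((n ! : ℝ) ^ 2) * ((x / 2) ^ 2) ^ n := by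
  simp only [besselJ0, pow_mul]

lemma besselJ1_eq (x : ℝ) : besselJ1 x = -((x / 2) * ∑' n : ℕ, ((n : ℝ) + 1) *
    ((-1 : ℝ) ^ (n + 1) / (((n + 1)! : ℝ) ^ 2)) * ((x / 2) ^ 2) ^ n) := by
  rw [besselJ1, ← tsum_mul_left, ← tsum_neg]
  refine tsum_congr fun n => ?_
  rw [Nat.factorial_succ]
  push_cast
  have : (n ! : ℝ) ≠ 0 := by positivity
  have : (n : ℝ) + 1 ≠ 0 := by positivity
  rw [← pow_mul, pow_succ (x / 2)]
  field_simp
  ring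

/-- With `t = (x / 2)²`, the series of `x J₁(x)` is `-2 t F'(t)`, where `J₀(x) = F(t)`. -/
lemma mul_besselJ1_eq (x : ℝ) : x * besselJ1 x = -2 * ∑' n : ℕ,
    ((n : ℝ) * ((-1 : ℝ) ^ n / ((n ! : ℝ) ^ 2))) * ((x / 2) ^ 2) ^ n := by
  have hs : Summable fun n : ℕ =>
      ((n : ℝ) * ((-1 : ℝ) ^ n / ((n ! : ℝ) ^ 2))) * ((x / 2) ^ 2) ^ n := by
    refine Summable.of_norm_bounded (summable_mul_bessel_coeff ((x / 2) ^ 2 + 1)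
      (by nlinarith [sq_nonneg (x / 2)])) fun n => ?_
    rw [norm_mul, norm_pow, Real.norm_eq_abs, Real.norm_eq_abs, abs_of_nonneg (sq_nonneg (x / 2))]
    gcongr
    linarith
  rw [besselJ1_eq, hs.tsum_eq_zero_add]
  simp only [Nat.cast_zero, zero_mul, zero_add]
  rw [mul_neg, ← mul_assoc, ← tsum_mul_left, ← tsum_mul_left, ← tsum_neg]
  refine tsum_congr fun n => ?_
  push_cast
  ring

lemma hasDerivAt_div_two_sq (x : ℝ) : HasDerivAt (fun x : ℝ => (x / 2) ^ 2) (x / 2) x := by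
  have := ((hasDerivAt_id x).div_const 2).pow 2
  refine this.congr_deriv ?_
  simp
  ring

lemma hasDerivAt_besselJ0 (x : ℝ) : HasDerivAt besselJ0 (-besselJ1 x) x := by
  have h := (hasDerivAt_tsum_mul_pow summable_bessel_coeff ((x / 2) ^ 2)).comp x
    (hasDerivAt_div_two_sq x)
  rw [funext besselJ0_eq, besselJ1_eq]
  refine h.congr_deriv ?_
  ring

lemma hasDerivAt_mul_besselJ1 (x : ℝ) :
    HasDerivAt (fun x => x * besselJ1 x) (x * besselJ0 x) x := by
  have h := ((hasDerivAt_tsum_mul_pow summable_mul_bessel_coeff ((x / 2) ^ 2)).comp x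
    (hasDerivAt_div_two_sq x)).const_mul (-2)
  rw [funext mul_besselJ1_eq, besselJ0_eq]
  refine h.congr_deriv ?_
  rw [← tsum_mul_left, ← tsum_mul_right, ← tsum_mul_left]
  refine tsum_congr fun n => ?_
  rw [Nat.factorial_succ]
  push_cast
  have : (n ! : ℝ) ≠ 0 := by positivity
  have : (n : ℝ) + 1 ≠ 0 := by positivity
  field_simp
  ring

lemma continuous_besselJ0 : Continuous besselJ0 :=
  continuous_iff_continuousAt.2 fun x => (hasDerivAt_besselJ0 x).continuousAt

lemma continuous_tsum_besselJ1 : Continuous fun t : ℝ => ∑' n : ℕ, ((n : ℝ) + 1) *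
    ((-1 : ℝ) ^ (n + 1) / (((n + 1)! : ℝ) ^ 2)) * t ^ n := by
  refine continuous_iff_continuousAt.2 fun t => (hasDerivAt_tsum_mul_pow
    (a := fun n => ((n : ℝ) + 1) * ((-1 : ℝ) ^ (n + 1) / (((n + 1)! : ℝ) ^ 2))) (fun r hr => ?_) t).continuousAt
  have := (summable_nat_add_iff 1).2 (summable_mul_bessel_coeff r hr)
  refine this.of_nonneg_of_le (fun n => by positivity) (fun n => ?_)
  push_cast
  gcongr
  exact n.le_succ

lemma continuous_besselJ1 : Continuous besselJ1 := by
  rw [funext besselJ1_eq]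
  exact ((continuous_id.div_const 2).mul
    (continuous_tsum_besselJ1.comp ((continuous_id.div_const 2).pow 2))).neg

lemma hasDerivAt_besselJ1 {x : ℝ} (hx : x ≠ 0) :
    HasDerivAt besselJ1 (besselJ0 x - besselJ1 x / x) x := by
  have h := (hasDerivAt_mul_besselJ1 x).div (hasDerivAt_id x) hx
  refine (h.congr_of_eventuallyEq ?_).congr_deriv ?_
  · filter_upwards [isOpen_ne.mem_nhds hx] with y hy
    have : y ≠ 0 := hy
    simp
    field_simp
  · simp
    field_simp

/-- `√x J₁(x)` is bounded. The energy `x (J₀² + J₁²) - J₀ J₁ + J₀² / (2 x)` of the equation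
`u'' + (1 + 1 / (4 x²)) u = 0` satisfied by `u = √x J₀` is nonincreasing, its derivative being
`-J₀² / (2 x²)`. -/
lemma exists_mul_sq_besselJ1_le : ∃ K : ℝ, ∀ x : ℝ, 1 ≤ x → x * besselJ1 x ^ 2 ≤ K := by
  set E : ℝ → ℝ := fun x => x * (besselJ0 x ^ 2 + besselJ1 x ^ 2) - besselJ0 x * besselJ1 x +
    besselJ0 x ^ 2 / (2 * x) with hE
  have hd : ∀ x : ℝ, 0 < x → HasDerivAt E (-(besselJ0 x ^ 2 / (2 * x ^ 2))) x := by
    intro x hx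
    have h0 := hasDerivAt_besselJ0 x
    have h1 := hasDerivAt_besselJ1 hx.ne'
    have := (((hasDerivAt_id x).mul ((h0.pow 2).add (h1.pow 2))).sub (h0.mul h1)).add
      ((h0.pow 2).div ((hasDerivAt_id x).const_mul 2) (by simp [hx.ne']))
    refine this.congr_deriv ?_
    simp
    field_simp
    ring
  have hanti : AntitoneOn E (Set.Ici 1) := by
    refine antitoneOn_of_deriv_nonpos (convex_Ici 1)
      (fun x hx => (hd x (lt_of_lt_of_le one_pos hx)).continuousAt.continuousWithinAt)
      (fun x hx => (hd x ?_).differentiableAt.differentiableWithinAt) (fun x hx => ?_)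
    · rw [interior_Ici] at hx; exact one_pos.trans hx
    · rw [interior_Ici] at hx
      rw [(hd x (one_pos.trans hx)).deriv]
      have : 0 ≤ besselJ0 x ^ 2 / (2 * x ^ 2) := by positivity
      linarith
  refine ⟨2 * E 1, fun x hx => ?_⟩
  have h1 := hanti (Set.mem_Ici.2 le_rfl) hx hx
  have h2 : 0 ≤ besselJ0 x ^ 2 / (2 * x) := by positivity
  have h3 : E x = x * (besselJ0 x ^ 2 + besselJ1 x ^ 2) - besselJ0 x * besselJ1 x +
    besselJ0 x ^ 2 / (2 * x) := rfl
  nlinarith [sq_nonneg (besselJ0 x - besselJ1 x), sq_nonneg (besselJ0 x), sq_nonneg (besselJ1 x),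
    mul_nonneg (sub_nonneg.2 hx) (sq_nonneg (besselJ0 x)),
    mul_nonneg (sub_nonneg.2 hx) (sq_nonneg (besselJ1 x))]

lemma besselJ1_isBigO_atTop : besselJ1 =O[atTop] fun x => x ^ (-(1 / 2) : ℝ) := by
  obtain ⟨K, hK⟩ := exists_mul_sq_besselJ1_le
  refine Asymptotics.IsBigO.of_bound (Real.sqrt K) ?_
  filter_upwards [eventually_ge_atTop 1] with x hx
  have hx0 : 0 < x := by linarith
  rw [Real.norm_eq_abs, Real.norm_eq_abs, Real.rpow_neg hx0.le, ← Real.sqrt_eq_rpow,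
    abs_of_nonneg (inv_nonneg.2 (Real.sqrt_nonneg x)), ← div_eq_mul_inv,
    le_div_iff₀ (Real.sqrt_pos.2 hx0)]
  apply Real.le_sqrt_of_sq_le
  rw [mul_pow, Real.sq_sqrt hx0.le, sq_abs]
  linarith [hK x hx]

lemma besselJ1_isBigO_nhds_zero : besselJ1 =O[𝓝[>] 0] fun x => x ^ (-(-1) : ℝ) := by
  have h2 : besselJ1 = fun x => x * (-(1 / 2) * ∑' n : ℕ, ((n : ℝ) + 1) *
    ((-1 : ℝ) ^ (n + 1) / (((n + 1)! : ℝ) ^ 2)) * ((x / 2) ^ 2) ^ n) := by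
    funext x
    rw [besselJ1_eq]
    ring
  rw [h2]
  have hc : Continuous fun x : ℝ => -(1 / 2) * ∑' n : ℕ, ((n : ℝ) + 1) *
    ((-1 : ℝ) ^ (n + 1) / (((n + 1)! : ℝ) ^ 2)) * ((x / 2) ^ 2) ^ n :=
    continuous_const.mul (continuous_tsum_besselJ1.comp ((continuous_id.div_const 2).pow 2))
  have h3 := ((hc.tendsto 0).isBigO_one ℝ).mono (nhdsWithin_le_nhds (s := Set.Ioi (0 : ℝ)))
  have h4 := (Asymptotics.isBigO_refl (fun x : ℝ => x) (𝓝[>] 0)).mul h3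
  simpa using h4

/-! ### The Gamma function on vertical lines -/

lemma norm_betaIntegral_le (a b : ℂ) :
    ‖a.betaIntegral b‖ ≤ ‖(a.re : ℂ).betaIntegral (b.re : ℂ)‖ := by
  have key : (a.re : ℂ).betaIntegral (b.re : ℂ) =
      ((∫ x : ℝ in (0 : ℝ)..1, x ^ (a.re - 1) * (1 - x) ^ (b.re - 1) : ℝ) : ℂ) := by
    rw [Complex.betaIntegral, ← intervalIntegral.integral_ofReal]
    refine intervalIntegral.integral_congr fun x hx => ?_
    rw [Set.uIcc_of_le zero_le_one] at hx
    have h1 : (0 : ℝ) ≤ 1 - x := by linarith [hx.2]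
    push_cast [Complex.ofReal_cpow hx.1, Complex.ofReal_cpow h1]
    rfl
  have hnn : 0 ≤ ∫ x : ℝ in (0 : ℝ)..1, x ^ (a.re - 1) * (1 - x) ^ (b.re - 1) := by
    refine intervalIntegral.integral_nonneg zero_le_one fun x hx => ?_
    have h1 : (0 : ℝ) ≤ 1 - x := by linarith [hx.2]
    have := hx.1
    positivity
  rw [key, Complex.norm_real, Real.norm_of_nonneg hnn, Complex.betaIntegral]
  refine (intervalIntegral.norm_integral_le_integral_norm zero_le_one).trans (le_of_eq ?_)
  rw [intervalIntegral.integral_of_le zero_le_one, intervalIntegral.integral_of_le zero_le_one,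
    integral_Ioc_eq_integral_Ioo, integral_Ioc_eq_integral_Ioo]
  refine setIntegral_congr_fun measurableSet_Ioo fun x hx => ?_
  have h1 : (0 : ℝ) < 1 - x := by linarith [hx.2]
  have h2 : (1 : ℂ) - x = ((1 - x : ℝ) : ℂ) := by push_cast; rfl
  simp only [norm_mul]
  rw [h2, Complex.norm_cpow_eq_rpow_re_of_pos hx.1, Complex.norm_cpow_eq_rpow_re_of_pos h1]
  simp

/-- On each horizontal line `|Γ(σ + iw)| / Γ(σ)` increases with `σ > 0`: the quotient of two of
its values is `|B(σ + iw, τ - σ)| / B(σ, τ - σ) ≤ 1`. -/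
lemma norm_Gamma_mul_le {σ τ w : ℝ} (hσ : 0 < σ) (hστ : σ < τ) :
    ‖Complex.Gamma (σ + w * Complex.I)‖ * Real.Gamma τ ≤
      Real.Gamma σ * ‖Complex.Gamma (τ + w * Complex.I)‖ := by
  have hτ : 0 < τ := hσ.trans hστ
  have hd : 0 < τ - σ := sub_pos.2 hστ
  have h1 := Complex.Gamma_mul_Gamma_eq_betaIntegral (s := σ + w * Complex.I)
    (t := ((τ - σ : ℝ) : ℂ)) (by simpa using hσ) (by simpa using hστ)
  have h2 := Complex.Gamma_mul_Gamma_eq_betaIntegral (s := (σ : ℂ))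
    (t := ((τ - σ : ℝ) : ℂ)) (by simpa using hσ) (by simpa using hστ)
  have h3 := norm_betaIntegral_le (σ + w * Complex.I) ((τ - σ : ℝ) : ℂ)
  have e1 : (σ : ℂ) + w * Complex.I + ((τ - σ : ℝ) : ℂ) = τ + w * Complex.I := by push_cast; ring
  have e2 : (σ : ℂ) + ((τ - σ : ℝ) : ℂ) = τ := by push_cast; ring
  have e3 : ((σ : ℂ) + w * Complex.I).re = σ := by simp
  rw [e1] at h1
  rw [e2] at h2
  rw [e3, Complex.ofReal_re] at h3
  replace h1 := congrArg norm h1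
  replace h2 := congrArg norm h2
  rw [norm_mul, norm_mul] at h1 h2
  simp only [Complex.Gamma_ofReal, Complex.norm_real,
    Real.norm_of_nonneg (Real.Gamma_pos_of_pos hσ).le,
    Real.norm_of_nonneg (Real.Gamma_pos_of_pos hd).le,
    Real.norm_of_nonneg (Real.Gamma_pos_of_pos hτ).le] at h1 h2
  have hpd := Real.Gamma_pos_of_pos hd
  have hpt := Real.Gamma_pos_of_pos hτ
  refine le_of_mul_le_mul_right ?_ hpd
  calc _ = (‖Complex.Gamma (σ + w * Complex.I)‖ * Real.Gamma (τ - σ)) * Real.Gamma τ := by ring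
    _ = ‖Complex.Gamma (τ + w * Complex.I)‖ *
        ‖(σ + w * Complex.I).betaIntegral ((τ - σ : ℝ) : ℂ)‖ * Real.Gamma τ := by rw [h1]
    _ ≤ ‖Complex.Gamma (τ + w * Complex.I)‖ *
        ‖(σ : ℂ).betaIntegral ((τ - σ : ℝ) : ℂ)‖ * Real.Gamma τ := by gcongr
    _ = ‖Complex.Gamma (τ + w * Complex.I)‖ *
        (Real.Gamma τ * ‖(σ : ℂ).betaIntegral ((τ - σ : ℝ) : ℂ)‖) := by ring
    _ = _ := by rw [← h2]; ring

/-- By the reflection formula, `|Γ(1/2 + iw)|² = π / cosh (π w)`. -/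
lemma norm_sq_Gamma_half (w : ℝ) :
    ‖Complex.Gamma ((1 / 2 : ℝ) + w * Complex.I)‖ ^ 2 = Real.pi / Real.cosh (Real.pi * w) := by
  have h := Complex.Gamma_mul_Gamma_one_sub ((1 / 2 : ℝ) + w * Complex.I)
  have e1 : 1 - (((1 / 2 : ℝ) : ℂ) + w * Complex.I) =
      (starRingEnd ℂ) (((1 / 2 : ℝ) : ℂ) + w * Complex.I) := by
    simp only [map_add, map_mul, Complex.conj_ofReal, Complex.conj_I]
    push_cast
    ring
  have e2 : (Real.pi : ℂ) * (((1 / 2 : ℝ) : ℂ) + w * Complex.I) =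
      ((Real.pi * w : ℝ) : ℂ) * Complex.I + Real.pi / 2 := by
    push_cast
    ring
  rw [e1, Complex.Gamma_conj, Complex.mul_conj, e2, Complex.sin_add_pi_div_two,
    Complex.cos_mul_I, ← Complex.ofReal_cosh, ← Complex.ofReal_div, Complex.ofReal_inj] at h
  rw [← h, Complex.normSq_eq_norm_sq]

lemma norm_Gamma_half_le (w : ℝ) : ‖Complex.Gamma ((1 / 2 : ℝ) + w * Complex.I)‖ ≤
    3 * Real.exp (-(Real.pi / 2 * |w|)) := by
  refine abs_le_of_sq_le_sq' ?_ (by positivity) |>.2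
  rw [norm_sq_Gamma_half, div_le_iff₀ (Real.cosh_pos _), mul_pow, ← Real.exp_nat_mul]
  have h1 : Real.exp (Real.pi * |w|) / 2 ≤ Real.cosh (Real.pi * w) := by
    rw [← Real.cosh_abs, abs_mul, abs_of_pos Real.pi_pos, Real.cosh_eq]
    linarith [Real.exp_pos (-(Real.pi * |w|))]
  have h2 : Real.exp (((2 : ℕ) : ℝ) * -(Real.pi / 2 * |w|)) * Real.exp (Real.pi * |w|) = 1 := by
    rw [← Real.exp_add, Real.exp_eq_one_iff]
    push_cast
    ring
  have h3 := Real.exp_pos (((2 : ℕ) : ℝ) * -(Real.pi / 2 * |w|))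
  nlinarith [Real.pi_lt_four, mul_le_mul_of_nonneg_left h1 h3.le]

lemma le_norm_Gamma_half (w : ℝ) :
    Real.exp (-(Real.pi / 2 * |w|)) ≤ ‖Complex.Gamma ((1 / 2 : ℝ) + w * Complex.I)‖ := by
  refine abs_le_of_sq_le_sq' ?_ (by positivity) |>.2
  rw [norm_sq_Gamma_half, le_div_iff₀ (Real.cosh_pos _), ← Real.exp_nat_mul]
  have h1 : Real.cosh (Real.pi * w) ≤ Real.exp (Real.pi * |w|) := by
    rw [← Real.cosh_abs, abs_mul, abs_of_pos Real.pi_pos, Real.cosh_eq]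
    have : Real.exp (-(Real.pi * |w|)) ≤ Real.exp (Real.pi * |w|) :=
      Real.exp_le_exp.2 (by linarith [mul_nonneg Real.pi_pos.le (abs_nonneg w)])
    linarith
  have h2 : Real.exp (((2 : ℕ) : ℝ) * -(Real.pi / 2 * |w|)) * Real.exp (Real.pi * |w|) = 1 := by
    rw [← Real.exp_add, Real.exp_eq_one_iff]
    push_cast
    ring
  have h3 := Real.exp_pos (((2 : ℕ) : ℝ) * -(Real.pi / 2 * |w|))
  nlinarith [Real.pi_gt_three, mul_le_mul_of_nonneg_left h1 h3.le]

lemma norm_Gamma_three_halves_le (w : ℝ) : ‖Complex.Gamma ((3 / 2 : ℝ) + w * Complex.I)‖ ≤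
    3 * (1 + |w|) * Real.exp (-(Real.pi / 2 * |w|)) := by
  have hne : ((1 / 2 : ℝ) : ℂ) + w * Complex.I ≠ 0 := by
    intro h
    have := congrArg Complex.re h
    simp at this
  have e : ((3 / 2 : ℝ) : ℂ) + w * Complex.I = (((1 / 2 : ℝ) : ℂ) + w * Complex.I) + 1 := by
    push_cast
    ring
  rw [e, Complex.Gamma_add_one _ hne, norm_mul]
  have h1 : ‖((1 / 2 : ℝ) : ℂ) + w * Complex.I‖ ≤ 1 + |w| := by
    refine (norm_add_le _ _).trans ?_
    rw [norm_mul, Complex.norm_I, Complex.norm_real, Complex.norm_real]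
    norm_num
  calc _ ≤ (1 + |w|) * (3 * Real.exp (-(Real.pi / 2 * |w|))) :=
        mul_le_mul h1 (norm_Gamma_half_le w) (norm_nonneg _) (by positivity)
    _ = _ := by ring

/-- On vertical strips inside `0 < Re s < 3/2` the Gamma function is `O((1 + |w|) e^{-π|w|/2})`. -/
lemma exists_norm_Gamma_le {a b : ℝ} (ha : 0 < a) (hb : b < 3 / 2) :
    ∃ K : ℝ, 0 < K ∧ ∀ s : ℂ, a ≤ s.re → s.re ≤ b →
      ‖Complex.Gamma s‖ ≤ K * ((1 + |s.im|) * Real.exp (-(Real.pi / 2 * |s.im|))) := by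
  have hc : ContinuousOn Real.Gamma (Set.Icc a b) := fun x hx =>
    (Real.differentiableAt_Gamma fun m => by
      have := hx.1
      have : (0 : ℝ) ≤ m := by positivity
      linarith).continuousAt.continuousWithinAt
  obtain ⟨M, hM⟩ := isCompact_Icc.exists_bound_of_continuousOn hc
  have hg : 0 < Real.Gamma (3 / 2) := Real.Gamma_pos_of_pos (by norm_num)
  refine ⟨(|M| + 1) * 3 / Real.Gamma (3 / 2), by positivity, fun s h1 h2 => ?_⟩
  have h3 := norm_Gamma_mul_le (w := s.im) (ha.trans_le h1) (h2.trans_lt hb)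
  rw [Complex.re_add_im] at h3
  rw [div_mul_eq_mul_div, le_div_iff₀ hg]
  refine h3.trans ?_
  have h4 : Real.Gamma s.re ≤ |M| + 1 := by
    have := (Real.le_norm_self _).trans (hM s.re ⟨h1, h2⟩)
    linarith [le_abs_self M]
  calc _ ≤ (|M| + 1) * (3 * (1 + |s.im|) * Real.exp (-(Real.pi / 2 * |s.im|))) :=
        mul_le_mul h4 (norm_Gamma_three_halves_le _) (norm_nonneg _) (by positivity)
    _ = _ := by ring

/-- On vertical strips inside `Re s > 1/2` the reciprocal Gamma function is `O(e^{π|w|/2})`. -/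
lemma exists_norm_inv_Gamma_le {a b : ℝ} (ha : 1 / 2 < a) :
    ∃ K : ℝ, 0 < K ∧ ∀ s : ℂ, a ≤ s.re → s.re ≤ b →
      ‖(Complex.Gamma s)⁻¹‖ ≤ K * Real.exp (Real.pi / 2 * |s.im|) := by
  have hc : ContinuousOn (fun x => (Real.Gamma x)⁻¹) (Set.Icc a b) := fun x hx => by
    have hx0 : 0 < x := by linarith [hx.1]
    exact ((Real.differentiableAt_Gamma fun m => by
      have : (0 : ℝ) ≤ m := by positivity
      linarith).continuousAt.inv₀ (Real.Gamma_pos_of_pos hx0).ne').continuousWithinAt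
  obtain ⟨M, hM⟩ := isCompact_Icc.exists_bound_of_continuousOn hc
  have hg : 0 < Real.Gamma (1 / 2) := Real.Gamma_pos_of_pos (by norm_num)
  refine ⟨(|M| + 1) * Real.Gamma (1 / 2), by positivity, fun s h1 h2 => ?_⟩
  have hs0 : 0 < s.re := by linarith
  have h3 := norm_Gamma_mul_le (σ := 1 / 2) (w := s.im) (by norm_num) (ha.trans_le h1)
  rw [Complex.re_add_im] at h3
  have h4 : (Real.Gamma s.re)⁻¹ ≤ |M| + 1 := by
    have := (Real.le_norm_self _).trans (hM s.re ⟨h1, h2⟩)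
    linarith [le_abs_self M]
  have h5 := (mul_le_mul_of_nonneg_right (le_norm_Gamma_half s.im)
    (Real.Gamma_pos_of_pos hs0).le).trans h3
  have hgs := Real.Gamma_pos_of_pos hs0
  have hn : 0 < ‖Complex.Gamma s‖ := norm_pos_iff.2 (Complex.Gamma_ne_zero_of_re_pos hs0)
  rw [norm_inv]
  calc ‖Complex.Gamma s‖⁻¹ ≤ (Real.Gamma s.re)⁻¹ * Real.Gamma (1 / 2) *
        Real.exp (Real.pi / 2 * |s.im|) := by
        rw [inv_le_iff_one_le_mul₀ hn]
        have h6 : Real.exp (-(Real.pi / 2 * |s.im|)) * Real.exp (Real.pi / 2 * |s.im|) = 1 := by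
          rw [← Real.exp_add, neg_add_cancel, Real.exp_zero]
        calc 1 = (Real.Gamma s.re)⁻¹ * (Real.exp (-(Real.pi / 2 * |s.im|)) * Real.Gamma s.re) *
              Real.exp (Real.pi / 2 * |s.im|) := by
              rw [mul_comm (Real.exp _), inv_mul_cancel_left₀ hgs.ne', h6]
          _ ≤ (Real.Gamma s.re)⁻¹ * (Real.Gamma (1 / 2) * ‖Complex.Gamma s‖) *
              Real.exp (Real.pi / 2 * |s.im|) := by gcongr
          _ = _ := by ring
    _ ≤ _ := by gcongr

/-! ### Contour integrals along vertical lines -/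

lemma continuous_vertical {f : ℂ → ℂ} {a b c : ℝ} (hc : ContinuousOn f {s | a ≤ s.re ∧ s.re ≤ b})
    (h1 : a ≤ c) (h2 : c ≤ b) : Continuous fun w : ℝ => f (c + w * Complex.I) :=
  hc.comp_continuous (by fun_prop) fun w => by simp [h1, h2]

lemma integrable_of_norm_le_div_sq {g : ℝ → ℂ} (hg : Continuous g) {K : ℝ}
    (hK : ∀ w, 1 ≤ |w| → ‖g w‖ ≤ K / w ^ 2) : Integrable g := by
  obtain ⟨M, hM⟩ := (isCompact_Icc (a := (-1 : ℝ)) (b := 1)).exists_bound_of_continuousOn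
    hg.continuousOn
  refine Integrable.mono' (integrable_inv_one_add_sq.const_mul (2 * (|M| + |K|)))
    hg.aestronglyMeasurable (Eventually.of_forall fun w => ?_)
  rw [← div_eq_mul_inv, le_div_iff₀ (by positivity)]
  rcases le_total 1 |w| with hw | hw
  · have hw2 : 1 ≤ w ^ 2 := by rw [← sq_abs]; nlinarith
    have h1 := hK w hw
    rw [le_div_iff₀ (by linarith)] at h1
    nlinarith [norm_nonneg (g w), le_abs_self K, abs_nonneg M]
  · have hw2 : w ^ 2 ≤ 1 := by rw [← sq_abs]; nlinarith [abs_nonneg w]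
    have h1 := hM w (abs_le.1 hw)
    nlinarith [norm_nonneg (g w), le_abs_self M, abs_nonneg K]

/-- Cauchy's theorem for a vertical strip: the integrals over its two edges agree. -/
lemma integral_vertical_eq {f : ℂ → ℂ} {a b K : ℝ} (hab : a < b)
    (hc : ContinuousOn f {s | a ≤ s.re ∧ s.re ≤ b})
    (hd : DifferentiableOn ℂ f {s | a < s.re ∧ s.re < b})
    (hK : ∀ s : ℂ, a ≤ s.re → s.re ≤ b → 1 ≤ |s.im| → ‖f s‖ ≤ K / s.im ^ 2) :
    ∫ w : ℝ, f (a + w * Complex.I) = ∫ w : ℝ, f (b + w * Complex.I) := by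
  have hia : Integrable fun w : ℝ => f (a + w * Complex.I) :=
    integrable_of_norm_le_div_sq (continuous_vertical hc le_rfl hab.le) (K := K)
      fun w hw => by simpa using hK (a + w * Complex.I) (by simp) (by simp [hab.le]) (by simpa)
  have hib : Integrable fun w : ℝ => f (b + w * Complex.I) :=
    integrable_of_norm_le_div_sq (continuous_vertical hc hab.le le_rfl) (K := K)
      fun w hw => by simpa using hK (b + w * Complex.I) (by simp [hab.le]) (by simp) (by simpa)
  have hla := intervalIntegral_tendsto_integral hia tendsto_neg_atTop_atBot tendsto_id
  have hlb := intervalIntegral_tendsto_integral hib tendsto_neg_atTop_atBot tendsto_id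
  have hdiff : Tendsto (fun T : ℝ => (∫ w in (-T)..T, f (b + w * Complex.I)) -
      ∫ w in (-T)..T, f (a + w * Complex.I)) atTop (𝓝 0) := by
    have hz : Tendsto (fun T : ℝ => 2 * (K * (b - a)) * (T ^ 2)⁻¹) atTop (𝓝 0) := by
      simpa using (tendsto_inv_atTop_zero.comp
        (tendsto_pow_atTop (α := ℝ) two_ne_zero)).const_mul (2 * (K * (b - a)))
    refine squeeze_zero_norm' ?_ hz
    filter_upwards [eventually_ge_atTop 1] with T hT
    have hrect := Complex.integral_boundary_rect_eq_zero_of_continuousOn_of_differentiableOn f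
      (a + (-T : ℝ) * Complex.I) (b + T * Complex.I) (hc.mono ?_) (hd.mono ?_)
    · simp only [Complex.add_re, Complex.ofReal_re, Complex.mul_re, Complex.I_re, mul_zero,
        Complex.ofReal_im, Complex.I_im, mul_one, sub_self, add_zero, Complex.add_im,
        Complex.mul_im, zero_add, smul_eq_mul] at hrect
      have hbound : ∀ t : ℝ, |t| = T →
          ‖∫ x in a..b, f (x + t * Complex.I)‖ ≤ K / T ^ 2 * (b - a) := by
        intro t ht
        have h := intervalIntegral.norm_integral_le_of_norm_le_const (a := a) (b := b)
          (f := fun x : ℝ => f (x + t * Complex.I)) (C := K / T ^ 2) fun x hx => ?_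
        · rwa [abs_of_pos (sub_pos.2 hab)] at h
        · rw [Set.uIoc_of_le hab.le] at hx
          have := hK (x + t * Complex.I) (by simpa using hx.1.le) (by simpa using hx.2)
            (by simpa [ht] using hT)
          simpa [← ht] using this
      have e : (∫ w in (-T)..T, f (b + w * Complex.I)) - ∫ w in (-T)..T, f (a + w * Complex.I) =
          Complex.I * ((∫ x in a..b, f (x + (-T : ℝ) * Complex.I)) -
            ∫ x in a..b, f (x + T * Complex.I)) := by
        have hI := Complex.I_mul_I
        linear_combination (-Complex.I) * hrect + ((∫ w in (-T)..T, f (b + w * Complex.I)) -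
          ∫ w in (-T)..T, f (a + w * Complex.I)) * hI
      rw [e, norm_mul, Complex.norm_I, one_mul]
      refine (norm_sub_le _ _).trans ?_
      have h1 := hbound (-T) (by rw [abs_neg, abs_of_nonneg (by linarith)])
      have h2 := hbound T (by rw [abs_of_nonneg (by linarith)])
      calc _ ≤ K / T ^ 2 * (b - a) + K / T ^ 2 * (b - a) := add_le_add h1 h2
        _ = _ := by rw [div_eq_mul_inv]; ring
    · intro s hs
      have := hs.1
      simpa [Set.uIcc_of_le hab.le] using this
    · intro s hs
      have := hs.1
      simpa [hab.le] using this
  have := tendsto_nhds_unique (hlb.sub hla) hdiff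
  exact (sub_eq_zero.1 this).symm

lemma integral_inv_add_sq {a : ℝ} (ha : 0 < a) :
    Integrable (fun w : ℝ => a / (a ^ 2 + w ^ 2)) ∧ ∫ w : ℝ, a / (a ^ 2 + w ^ 2) = Real.pi := by
  have e : ∀ w : ℝ, a / (a ^ 2 + w ^ 2) = a⁻¹ * (1 + (a⁻¹ * w) ^ 2)⁻¹ := fun w => by
    have : a ^ 2 + w ^ 2 ≠ 0 := by positivity
    field_simp
  simp only [e]
  refine ⟨(integrable_inv_one_add_sq.comp_mul_left' (inv_ne_zero ha.ne')).const_mul _, ?_⟩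
  rw [integral_const_mul, Measure.integral_comp_mul_left (fun x => (1 + x ^ 2)⁻¹),
    integral_univ_inv_one_add_sq, inv_inv, abs_of_pos ha, smul_eq_mul, inv_mul_cancel_left₀ ha.ne']

/-- Symmetrization in `w` turns the integrand into a difference of two Poisson kernels. -/
lemma integral_inv_sub_inv {a b : ℝ} (ha : a ≠ 0) (hb : 0 < b) :
    Integrable (fun w : ℝ => ((a : ℂ) + w * Complex.I)⁻¹ - ((b : ℂ) + w * Complex.I)⁻¹) ∧
    ∫ w : ℝ, (((a : ℂ) + w * Complex.I)⁻¹ - ((b : ℂ) + w * Complex.I)⁻¹) =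
      if 0 < a then 0 else -(2 * (Real.pi : ℂ)) := by
  have hne : ∀ c : ℝ, c ≠ 0 → ∀ w : ℝ, (c : ℂ) + w * Complex.I ≠ 0 := fun c hc w h => by
    have := congrArg Complex.re h
    simp at this
    exact hc this
  have hcont : Continuous fun w : ℝ => ((a : ℂ) + w * Complex.I)⁻¹ - ((b : ℂ) + w * Complex.I)⁻¹ :=
    ((Continuous.inv₀ (by fun_prop) (hne a ha)).sub (Continuous.inv₀ (by fun_prop) (hne b hb.ne')))
  have hle : ∀ c w : ℝ, |w| ≤ ‖(c : ℂ) + w * Complex.I‖ := fun c w => by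
    simpa using Complex.abs_im_le_norm ((c : ℂ) + w * Complex.I)
  have hint := integrable_of_norm_le_div_sq hcont (K := |b - a|) fun w hw => by
    rw [inv_sub_inv (hne a ha w) (hne b hb.ne' w), norm_div, norm_mul]
    have e : (b : ℂ) + w * Complex.I - (a + w * Complex.I) = ((b - a : ℝ) : ℂ) := by
      push_cast; ring
    rw [e, Complex.norm_real, Real.norm_eq_abs, ← sq_abs w, sq]
    have := hle a w
    have := hle b w
    gcongr
  refine ⟨hint, ?_⟩
  set g : ℝ → ℂ := fun w => ((a : ℂ) + w * Complex.I)⁻¹ - ((b : ℂ) + w * Complex.I)⁻¹ with hg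
  have hneg : ∫ w, g (-w) = ∫ w, g w := integral_neg_eq_self g volume
  have hsum : ∀ w, g w + g (-w) =
      ((2 * (a / (a ^ 2 + w ^ 2)) - 2 * (b / (b ^ 2 + w ^ 2)) : ℝ) : ℂ) := by
    have aux : ∀ c : ℝ, c ≠ 0 → ∀ w : ℝ, ((c : ℂ) + w * Complex.I)⁻¹ +
        ((c : ℂ) + (-w : ℝ) * Complex.I)⁻¹ = ((2 * (c / (c ^ 2 + w ^ 2)) : ℝ) : ℂ) := by
      intro c hc w
      have h1 := hne c hc w
      have h2 := hne c hc (-w)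
      have h3 : ((c : ℂ) + w * Complex.I) * ((c : ℂ) + (-w : ℝ) * Complex.I) =
          ((c ^ 2 + w ^ 2 : ℝ) : ℂ) := by
        push_cast
        linear_combination (-(w : ℂ) ^ 2) * Complex.I_sq
      rw [inv_add_inv h1 h2, h3]
      push_cast
      ring
    intro w
    have h1 := aux a ha w
    have h2 := aux b hb.ne' w
    rw [Complex.ofReal_sub, ← h1, ← h2]
    simp only [hg]
    ring
  have h2 : 2 * ∫ w, g w = ∫ w, (g w + g (-w)) := by
    rw [integral_add hint hint.comp_neg, hneg, two_mul]
  have hpb := integral_inv_add_sq hb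
  have hval : ∫ w, (g w + g (-w)) = if 0 < a then 0 else -(4 * (Real.pi : ℂ)) := by
    simp only [hsum]
    rw [integral_complex_ofReal]
    split_ifs with h0
    · have hpa := integral_inv_add_sq h0
      rw [integral_sub (hpa.1.const_mul 2) (hpb.1.const_mul 2), integral_const_mul,
        integral_const_mul, hpa.2, hpb.2]
      simp
    · have h0' : 0 < -a := by
        rcases lt_or_gt_of_ne ha with h | h
        · linarith
        · exact absurd h h0
      have hpa := integral_inv_add_sq h0'
      have e : ∀ w : ℝ, 2 * (a / (a ^ 2 + w ^ 2)) - 2 * (b / (b ^ 2 + w ^ 2)) =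
          -2 * (-a / ((-a) ^ 2 + w ^ 2)) - 2 * (b / (b ^ 2 + w ^ 2)) := fun w => by
        rw [neg_sq]; ring
      simp only [e]
      rw [integral_sub (hpa.1.const_mul (-2)) (hpb.1.const_mul 2), integral_const_mul,
        integral_const_mul, hpa.2, hpb.2]
      push_cast
      ring
  rw [hval] at h2
  split_ifs with h0
  · simpa [h0] using h2
  · rw [if_neg h0] at h2
    linear_combination h2 / 2

/-- Cauchy's integral formula at `0` for a vertical strip `a ≤ Re s ≤ b` around the imaginary
axis. -/
lemma integral_vertical_div {F : ℂ → ℂ} {a b K : ℝ} (ha : a < 0) (hb : 0 < b)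
    (hc : ContinuousOn F {s | a ≤ s.re ∧ s.re ≤ b})
    (hd : DifferentiableOn ℂ F {s | a < s.re ∧ s.re < b})
    (hK : ∀ s : ℂ, a ≤ s.re → s.re ≤ b → 1 ≤ |s.im| → ‖F s‖ ≤ K / |s.im|) :
    (∫ w : ℝ, F (b + w * Complex.I) / (b + w * Complex.I)) -
      ∫ w : ℝ, F (a + w * Complex.I) / (a + w * Complex.I) = 2 * Real.pi * F 0 := by
  -- Subtract the multiple of `1 / s - 1 / (s + L)` with the same residue; `L` puts its other pole
  -- outside the strip.
  set L : ℝ := 1 - a with hL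
  have hopen : {s : ℂ | a < s.re ∧ s.re < b} ∈ 𝓝 (0 : ℂ) :=
    ((isOpen_lt continuous_const Complex.continuous_re).inter
      (isOpen_lt Complex.continuous_re continuous_const)).mem_nhds ⟨by simpa, by simpa⟩
  have hclosed : {s : ℂ | a ≤ s.re ∧ s.re ≤ b} ∈ 𝓝 (0 : ℂ) :=
    mem_of_superset hopen fun s hs => ⟨hs.1.le, hs.2.le⟩
  have hneL : ∀ s : ℂ, a ≤ s.re → s + L ≠ 0 := fun s hs h => by
    have := congrArg Complex.re h
    simp [hL] at this
    linarith
  set Φ : ℂ → ℂ := fun s => F s - F 0 * (L / (s + L)) with hΦ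
  have hΦ0 : Φ 0 = 0 := by
    have : (L : ℂ) ≠ 0 := by simpa using hneL 0 (by simpa using ha.le)
    simp [hΦ, this]
  have hΦd : DifferentiableOn ℂ Φ {s | a < s.re ∧ s.re < b} :=
    hd.sub (DifferentiableOn.const_mul (DifferentiableOn.div (by fun_prop) (by fun_prop)
      fun s hs => hneL s hs.1.le) _)
  have hΦc : ContinuousOn Φ {s | a ≤ s.re ∧ s.re ≤ b} :=
    hc.sub (ContinuousOn.mul continuousOn_const (ContinuousOn.div (by fun_prop) (by fun_prop)
      fun s hs => hneL s hs.1))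
  have hval : ∀ s : ℂ, a ≤ s.re → s ≠ 0 →
      dslope Φ 0 s = F s / s - F 0 * (s⁻¹ - (s + L)⁻¹) := by
    intro s hs hs0
    have := hneL s hs
    rw [dslope_of_ne _ hs0, slope_def_field, hΦ0]
    simp only [hΦ, sub_zero]
    field_simp
    ring
  have hbd : ∀ s : ℂ, a ≤ s.re → s.re ≤ b → 1 ≤ |s.im| →
      ‖dslope Φ 0 s‖ ≤ (K + ‖F 0‖ * L) / s.im ^ 2 := by
    intro s h1 h2 h3
    have hs0 : s ≠ 0 := fun h => by simp [h] at h3; linarith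
    have hw : 0 < |s.im| := by linarith
    have h4 := Complex.abs_im_le_norm s
    have h5 : |s.im| ≤ ‖s + L‖ := by simpa using Complex.abs_im_le_norm (s + L)
    have hL0 : 0 < L := by rw [hL]; linarith
    rw [hval s h1 hs0, inv_sub_inv hs0 (hneL s h1), add_sub_cancel_left, add_div, ← sq_abs]
    refine (norm_sub_le _ _).trans (add_le_add ?_ ?_)
    · rw [norm_div, sq, ← div_div]
      exact div_le_div₀ ((norm_nonneg _).trans (hK s h1 h2 h3)) (hK s h1 h2 h3) hw h4
    · rw [norm_mul, norm_div, norm_mul, Complex.norm_real, Real.norm_of_nonneg hL0.le,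
        mul_div_assoc, sq]
      gcongr
  have key := integral_vertical_eq (f := dslope Φ 0) (ha.trans hb)
    ((continuousOn_dslope hclosed).2 ⟨hΦc, (hΦd.differentiableAt hopen)⟩)
    ((Complex.differentiableOn_dslope hopen).2 hΦd) hbd
  have hline : ∀ c : ℝ, a ≤ c → c ≤ b → c ≠ 0 → ∫ w : ℝ, dslope Φ 0 (c + w * Complex.I) =
      (∫ w : ℝ, F (c + w * Complex.I) / (c + w * Complex.I)) -
        F 0 * if 0 < c then 0 else -(2 * (Real.pi : ℂ)) := by
    intro c h1 h2 h3
    have hne : ∀ w : ℝ, (c : ℂ) + w * Complex.I ≠ 0 := fun w h => by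
      have := congrArg Complex.re h
      simp at this
      exact h3 this
    have hk := integral_inv_sub_inv h3 (b := c + L) (by rw [hL]; linarith)
    rw [← hk.2, ← integral_const_mul, ← integral_sub ?_ (hk.1.const_mul _)]
    · refine integral_congr_ae (Eventually.of_forall fun w => ?_)
      simp only
      rw [hval _ (by simpa using h1) (hne w)]
      push_cast
      ring
    · refine integrable_of_norm_le_div_sq (K := K)
        ((continuous_vertical hc h1 h2).div (by fun_prop) hne) fun w hw => ?_
      have h4 := hK (c + w * Complex.I) (by simpa using h1) (by simpa using h2) (by simpa using hw)
      have h5 : |w| ≤ ‖(c : ℂ) + w * Complex.I‖ := by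
        simpa using Complex.abs_im_le_norm ((c : ℂ) + w * Complex.I)
      have hw0 : 0 < |w| := by linarith
      simp only [Complex.add_im, Complex.ofReal_im, Complex.mul_im, Complex.ofReal_re,
        Complex.I_im, mul_one, Complex.I_re, mul_zero, add_zero, zero_add] at h4
      rw [norm_div, ← sq_abs, sq, ← div_div]
      exact div_le_div₀ ((norm_nonneg _).trans h4) h4 hw0 h5
  rw [hline a le_rfl (ha.trans hb).le ha.ne, hline b (ha.trans hb).le le_rfl hb.ne',
    if_pos hb, if_neg ha.not_gt] at key
  linear_combination -key

/-! ### Ramanujan's master theorem -/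

lemma exists_pow_mul_exp_neg_le {ε : ℝ} (hε : 0 < ε) :
    ∃ K : ℝ, 0 < K ∧ ∀ t : ℝ, 0 ≤ t → (1 + t) ^ 4 * Real.exp (-(ε * t)) ≤ K := by
  refine ⟨24 / ε ^ 4 * Real.exp ε, by positivity, fun t ht => ?_⟩
  have h := Real.pow_div_factorial_le_exp (ε * (1 + t)) (by positivity) 4
  have e : Real.exp (ε * (1 + t)) = Real.exp ε * Real.exp (ε * t) := by
    rw [← Real.exp_add]; ring_nf
  have h4 : ((4 ! : ℕ) : ℝ) = 24 := by norm_num [Nat.factorial]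
  rw [h4, div_le_iff₀ (by norm_num), mul_pow, e] at h
  rw [Real.exp_neg, ← div_eq_mul_inv, div_le_iff₀ (Real.exp_pos _), div_mul_eq_mul_div,
    div_mul_eq_mul_div, le_div_iff₀ (by positivity)]
  linarith

/-- The decay `Γ(s) = O((1 + |w|) e^{-π|w|/2})`, `w = Im s`, beats a growth `e^{A|w|}` with
`A < π / 2`. -/
lemma exists_Gamma_mul_exp_le {a b A : ℝ} (ha : 0 < a) (hb : b < 3 / 2) (hA : A < Real.pi / 2) :
    ∃ K : ℝ, 0 < K ∧ ∀ s : ℂ, a ≤ s.re → s.re ≤ b →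
      ‖Complex.Gamma s‖ * Real.exp (A * |s.im|) * (1 + |s.im|) ^ 3 ≤ K := by
  obtain ⟨K, hK, hG⟩ := exists_norm_Gamma_le ha hb
  obtain ⟨M, hM, hE⟩ := exists_pow_mul_exp_neg_le (sub_pos.2 hA)
  refine ⟨K * M, by positivity, fun s h1 h2 => ?_⟩
  have e : Real.exp (-((Real.pi / 2 - A) * |s.im|)) =
      Real.exp (-(Real.pi / 2 * |s.im|)) * Real.exp (A * |s.im|) := by
    rw [← Real.exp_add]; ring_nf
  have h3 := hE |s.im| (abs_nonneg _)
  rw [e] at h3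
  calc _ ≤ K * ((1 + |s.im|) * Real.exp (-(Real.pi / 2 * |s.im|))) * Real.exp (A * |s.im|) *
        (1 + |s.im|) ^ 3 := by gcongr; exact hG s h1 h2
    _ = K * ((1 + |s.im|) ^ 4 * (Real.exp (-(Real.pi / 2 * |s.im|)) *
        Real.exp (A * |s.im|))) := by ring
    _ ≤ _ := by gcongr

/-- `F` is regular on the half-plane `Re s ≥ -δ` and `O(e^{A |Im s|})` on each of its vertical
strips. -/
def RegularGrowth (δ A : ℝ) (F : ℂ → ℂ) : Prop :=
  DifferentiableOn ℂ F {s | -δ ≤ s.re} ∧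
    ∀ b : ℝ, ∃ C : ℝ, ∀ s : ℂ, -δ ≤ s.re → s.re ≤ b → ‖F s‖ ≤ C * Real.exp (A * |s.im|)

/-- The operation on interpolating functions that corresponds to moving the contour of
`∫ Γ(-s) F(s) ds` over one pole: `Γ(-s - 1) F(s + 1) = Γ(-s) (gammaShift F)(s)`. -/
noncomputable def gammaShift (F : ℂ → ℂ) (s : ℂ) : ℂ := -(F (s + 1) / (s + 1))

lemma half_le_norm_add_one {δ : ℝ} (hδ : δ ≤ 1 / 2) {s : ℂ} (hs : -δ ≤ s.re) :
    1 / 2 ≤ ‖s + 1‖ := by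
  have := (le_abs_self _).trans (Complex.abs_re_le_norm (s + 1))
  simp at this
  linarith

lemma add_one_ne_zero_of_re {δ : ℝ} (hδ : δ ≤ 1 / 2) {s : ℂ} (hs : -δ ≤ s.re) : s + 1 ≠ 0 :=
  norm_pos_iff.1 (by linarith [half_le_norm_add_one hδ hs])

lemma RegularGrowth.gammaShift {δ A : ℝ} {F : ℂ → ℂ} (hF : RegularGrowth δ A F)
    (hδ : δ ≤ 1 / 2) : RegularGrowth δ A (gammaShift F) := by
  constructor
  · refine (DifferentiableOn.div (hF.1.comp (by fun_prop) fun s hs => ?_) (by fun_prop)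
      fun s hs => add_one_ne_zero_of_re hδ hs).neg
    have hs' : -δ ≤ s.re := hs
    change -δ ≤ (s + 1).re
    rw [Complex.add_re, Complex.one_re]
    linarith
  · intro b
    obtain ⟨C, hC⟩ := hF.2 (b + 1)
    refine ⟨2 * C, fun s h1 h2 => ?_⟩
    have h3 := hC (s + 1) (by simp; linarith) (by simpa using h2)
    have h4 := half_le_norm_add_one hδ h1
    simp only [Complex.add_im, Complex.one_im, add_zero] at h3
    rw [_root_.gammaShift, norm_neg, norm_div, div_le_iff₀ (by linarith)]
    nlinarith [(norm_nonneg _).trans h3]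

lemma differentiableOn_Gamma_one_sub {δ : ℝ} (hδ : 0 < δ) :
    DifferentiableOn ℂ (fun s => Complex.Gamma (1 - s)) {s : ℂ | s.re ≤ 1 - δ} := by
  intro s hs
  refine ((Complex.differentiableAt_Gamma (1 - s) fun m h => ?_).comp s
    (by fun_prop)).differentiableWithinAt
  have h1 := congrArg Complex.re h
  have h2 : s.re ≤ 1 - δ := hs
  have : (0 : ℝ) ≤ m := by positivity
  simp at h1
  linarith

/-- Moving the line of integration of `∫ Γ(-s) F(s) ds` from `Re s = -δ` to `Re s = 1 - δ` picks
up the residue at `s = 0`. -/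
lemma integral_Gamma_mul_eq_add {δ A : ℝ} {F : ℂ → ℂ} (hF : RegularGrowth δ A F) (hδ0 : 0 < δ)
    (hδ : δ < 1 / 2) (hA : A < Real.pi / 2) :
    ∫ w : ℝ, Complex.Gamma (-((-δ : ℝ) + w * Complex.I)) * F ((-δ : ℝ) + w * Complex.I) =
      2 * Real.pi * F 0 + ∫ w : ℝ, Complex.Gamma (-((-δ : ℝ) + w * Complex.I)) *
        gammaShift F ((-δ : ℝ) + w * Complex.I) := by
  obtain ⟨K, hK, hG⟩ := exists_Gamma_mul_exp_le (a := δ) (b := 1 + δ) hδ0 (by linarith) hA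
  obtain ⟨C, hC⟩ := hF.2 (1 - δ)
  have hdiff : DifferentiableOn ℂ (fun s => Complex.Gamma (1 - s) * F s)
      {s | -δ ≤ s.re ∧ s.re ≤ 1 - δ} :=
    ((differentiableOn_Gamma_one_sub hδ0).mono fun s hs => hs.2).mul (hF.1.mono fun s hs => hs.1)
  have key := integral_vertical_div (F := fun s => Complex.Gamma (1 - s) * F s) (a := -δ)
    (b := 1 - δ) (K := K * |C|) (by linarith) (by linarith) hdiff.continuousOn
    (hdiff.mono fun s hs => ⟨hs.1.le, hs.2.le⟩) fun s h1 h2 h3 => by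
      have h4 := hG (1 - s) (by simp; linarith) (by simp; linarith)
      have h5 : ‖F s‖ ≤ |C| * Real.exp (A * |s.im|) :=
        (hC s h1 h2).trans (by gcongr; exact le_abs_self C)
      have h6 : |(1 - s).im| = |s.im| := by simp
      rw [h6] at h4
      rw [norm_mul, le_div_iff₀ (by linarith)]
      have h7 : |s.im| ≤ (1 + |s.im|) ^ 3 := by
        nlinarith [abs_nonneg s.im, pow_nonneg (abs_nonneg s.im) 3]
      calc _ ≤ ‖Complex.Gamma (1 - s)‖ * (|C| * Real.exp (A * |s.im|)) * (1 + |s.im|) ^ 3 := by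
            gcongr
        _ = ‖Complex.Gamma (1 - s)‖ * Real.exp (A * |s.im|) * (1 + |s.im|) ^ 3 * |C| := by ring
        _ ≤ _ := by gcongr
  have hl : ∀ w : ℝ, Complex.Gamma (1 - ((-δ : ℝ) + w * Complex.I)) *
      F ((-δ : ℝ) + w * Complex.I) / ((-δ : ℝ) + w * Complex.I) =
      -(Complex.Gamma (-((-δ : ℝ) + w * Complex.I)) * F ((-δ : ℝ) + w * Complex.I)) := by
    intro w
    set s : ℂ := (-δ : ℝ) + w * Complex.I with hs
    have hs0 : s ≠ 0 := fun h => by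
      have := congrArg Complex.re h
      simp [hs] at this
      linarith
    have := Complex.Gamma_add_one (-s) (neg_ne_zero.2 hs0)
    rw [sub_eq_neg_add, this]
    field_simp
  have hr : ∀ w : ℝ, Complex.Gamma (1 - ((1 - δ : ℝ) + w * Complex.I)) *
      F ((1 - δ : ℝ) + w * Complex.I) / ((1 - δ : ℝ) + w * Complex.I) =
      -(Complex.Gamma (-((-δ : ℝ) + w * Complex.I)) *
        gammaShift F ((-δ : ℝ) + w * Complex.I)) := by
    intro w
    set s : ℂ := (-δ : ℝ) + w * Complex.I with hs
    have e : ((1 - δ : ℝ) : ℂ) + w * Complex.I = s + 1 := by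
      rw [hs]; push_cast; ring
    rw [e, gammaShift, sub_add_cancel_right]
    ring
  simp only [hl, hr, sub_zero, Complex.Gamma_one, one_mul, integral_neg] at key
  linear_combination key

lemma gammaShift_iterate (F : ℂ → ℂ) (N : ℕ) (s : ℂ) : gammaShift^[N] F s =
    (-1) ^ N * F (s + N) / ∏ k ∈ Finset.range N, (s + 1 + k) := by
  induction N generalizing s with
  | zero => simp
  | succ N ih =>
    rw [Function.iterate_succ_apply', gammaShift, ih, Finset.prod_range_succ']
    have e : ∀ k : ℕ, s + 1 + ((k + 1 : ℕ) : ℂ) = s + 1 + 1 + k := fun k => by push_cast; ring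
    simp only [e, Nat.cast_zero, add_zero]
    have e2 : s + 1 + (N : ℂ) = s + ((N + 1 : ℕ) : ℂ) := by push_cast; ring
    rw [e2, pow_succ, div_div]
    ring

lemma RegularGrowth.gammaShift_iterate {δ A : ℝ} {F : ℂ → ℂ} (hF : RegularGrowth δ A F)
    (hδ : δ ≤ 1 / 2) (N : ℕ) : RegularGrowth δ A (_root_.gammaShift^[N] F) := by
  induction N with
  | zero => exact hF
  | succ N ih => rw [Function.iterate_succ_apply']; exact ih.gammaShift hδ

lemma integral_Gamma_mul_eq_sum_add {δ A : ℝ} {F : ℂ → ℂ} (hF : RegularGrowth δ A F)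
    (hδ0 : 0 < δ) (hδ : δ < 1 / 2) (hA : A < Real.pi / 2) (N : ℕ) :
    ∫ w : ℝ, Complex.Gamma (-((-δ : ℝ) + w * Complex.I)) * F ((-δ : ℝ) + w * Complex.I) =
      2 * Real.pi * ∑ m ∈ Finset.range N, (-1) ^ m * F m / m ! +
      ∫ w : ℝ, Complex.Gamma (-((-δ : ℝ) + w * Complex.I)) *
        gammaShift^[N] F ((-δ : ℝ) + w * Complex.I) := by
  induction N with
  | zero => simp
  | succ N ih =>
    rw [ih, integral_Gamma_mul_eq_add (hF.gammaShift_iterate hδ.le N) hδ0 hδ hA,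
      Finset.sum_range_succ, Function.iterate_succ_apply', _root_.gammaShift_iterate F N 0]
    have e : ∏ k ∈ Finset.range N, ((0 : ℂ) + 1 + k) = (N ! : ℂ) := by
      rw [← Finset.prod_range_add_one_eq_factorial]
      push_cast
      exact Finset.prod_congr rfl fun k _ => by ring
    rw [e, zero_add]
    ring

lemma norm_gammaShift_iterate_le {δ : ℝ} (hδ : δ ≤ 1 / 2) (F : ℂ → ℂ) (N : ℕ) {s : ℂ}
    (hs : -δ ≤ s.re) : ‖gammaShift^[N] F s‖ ≤ 2 ^ N / N ! * ‖F (s + N)‖ := by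
  have hprod : (N ! : ℝ) / 2 ^ N ≤ ‖∏ k ∈ Finset.range N, (s + 1 + k)‖ := by
    have e : (N ! : ℝ) / 2 ^ N = ∏ k ∈ Finset.range N, ((k : ℝ) + 1) / 2 := by
      rw [Finset.prod_div_distrib, ← Finset.prod_range_add_one_eq_factorial]
      push_cast
      simp
    rw [e, norm_prod]
    refine Finset.prod_le_prod (fun k _ => by positivity) fun k _ => ?_
    have := (le_abs_self _).trans (Complex.abs_re_le_norm (s + 1 + k))
    simp at this
    have : (0 : ℝ) ≤ k := by positivity
    linarith
  have hpos : (0 : ℝ) < (N ! : ℝ) / 2 ^ N := by positivity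
  rw [gammaShift_iterate, norm_div, norm_mul, norm_pow, norm_neg, norm_one, one_pow, one_mul,
    mul_comm (2 ^ N / (N ! : ℝ)), ← inv_div (N ! : ℝ), ← div_eq_mul_inv]
  gcongr

/-- The Cahen–Mellin type integral of an interpolating function of exponential growth equals the
power series with the interpolated coefficients. -/
lemma tendsto_sum_integral_Gamma_mul {δ A : ℝ} {F : ℂ → ℂ} (hF : RegularGrowth δ A F)
    (hδ0 : 0 < δ) (hδ : δ < 1 / 2) (hA : A < Real.pi / 2) {C B : ℝ} (hB : 0 ≤ B)
    (hbd : ∀ (N : ℕ) (w : ℝ), ‖F ((-δ : ℝ) + w * Complex.I + N)‖ ≤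
      C * B ^ N * Real.exp (A * |w|)) :
    Tendsto (fun N : ℕ => 2 * (Real.pi : ℂ) * ∑ m ∈ Finset.range N, (-1) ^ m * F m / m !) atTop
      (𝓝 (∫ w : ℝ, Complex.Gamma (-((-δ : ℝ) + w * Complex.I)) *
        F ((-δ : ℝ) + w * Complex.I))) := by
  obtain ⟨K, hK, hG⟩ := exists_Gamma_mul_exp_le (a := δ) (b := δ) hδ0 (by linarith) hA
  set I := ∫ w : ℝ, (1 + w ^ 2)⁻¹ with hI
  have hC : 0 ≤ C := by
    have := (norm_nonneg _).trans (hbd 0 0)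
    simpa using this
  have hrem : Tendsto (fun N : ℕ => ∫ w : ℝ, Complex.Gamma (-((-δ : ℝ) + w * Complex.I)) *
      gammaShift^[N] F ((-δ : ℝ) + w * Complex.I)) atTop (𝓝 0) := by
    have hCB : ∀ N : ℕ, 0 ≤ C * ((2 * B) ^ N / N !) := fun N =>
      mul_nonneg hC (div_nonneg (pow_nonneg (mul_nonneg zero_le_two hB) N) (Nat.cast_nonneg _))
    have hz : Tendsto (fun N : ℕ => K * C * I * ((2 * B) ^ N / N !)) atTop (𝓝 0) := by
      simpa using (FloorSemiring.tendsto_pow_div_factorial_atTop (2 * B)).const_mul (K * C * I)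
    refine squeeze_zero_norm (fun N => ?_) hz
    rw [hI, mul_comm (K * C), mul_assoc, ← integral_mul_const]
    refine norm_integral_le_of_norm_le (integrable_inv_one_add_sq.mul_const _)
      (Eventually.of_forall fun w => ?_)
    have h1 := hG (-((-δ : ℝ) + w * Complex.I)) (by simp) (by simp)
    have h2 : |(-(((-δ : ℝ) : ℂ) + w * Complex.I)).im| = |w| := by simp
    rw [h2] at h1
    have h3 := norm_gammaShift_iterate_le hδ.le F N (s := (-δ : ℝ) + w * Complex.I) (by simp)
    have h4 : 1 + w ^ 2 ≤ (1 + |w|) ^ 3 := by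
      rw [← sq_abs]
      nlinarith [abs_nonneg w, pow_nonneg (abs_nonneg w) 3]
    rw [norm_mul, inv_mul_eq_div, le_div_iff₀ (by positivity)]
    calc _ ≤ ‖Complex.Gamma (-((-δ : ℝ) + w * Complex.I))‖ *
          (2 ^ N / N ! * (C * B ^ N * Real.exp (A * |w|))) * (1 + |w|) ^ 3 := by
          gcongr
          exact h3.trans (by gcongr; exact hbd N w)
      _ = ‖Complex.Gamma (-((-δ : ℝ) + w * Complex.I))‖ * Real.exp (A * |w|) * (1 + |w|) ^ 3 *
          (C * ((2 * B) ^ N / N !)) := by rw [mul_pow]; ring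
      _ ≤ K * (C * ((2 * B) ^ N / N !)) := mul_le_mul_of_nonneg_right h1 (hCB N)
      _ = _ := by ring
  have h := tendsto_const_nhds (x := ∫ w : ℝ, Complex.Gamma (-((-δ : ℝ) + w * Complex.I)) *
        F ((-δ : ℝ) + w * Complex.I)) |>.sub hrem
  rw [sub_zero] at h
  refine h.congr fun N => ?_
  rw [integral_Gamma_mul_eq_sum_add hF hδ0 hδ hA N]
  ring

/-- The Taylor series of `h` at `0` has the sum `h x` on all of `[0, ∞)`: its coefficients make it
entire, so the identity theorem applies along the half-line. -/
lemma hasSum_taylor_of_nonneg {h hbar : ℂ → ℂ} {C B : ℝ}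
    (h_regular : ∀ x : ℝ, 0 ≤ x → AnalyticAt ℂ h (x : ℂ))
    (h_taylor : ∀ᶠ z : ℂ in 𝓝 0,
      HasSum (fun m : ℕ => hbar (m : ℂ) / (m ! : ℂ) * (-z) ^ m) (h z))
    (hbd : ∀ m : ℕ, ‖hbar m‖ ≤ C * B ^ m) {x : ℝ} (hx : 0 ≤ x) :
    HasSum (fun m : ℕ => hbar (m : ℂ) / (m ! : ℂ) * (-(x : ℂ)) ^ m) (h x) := by
  have hle : ∀ (r : ℝ) (m : ℕ) (z : ℂ), ‖z‖ ≤ r →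
      ‖hbar (m : ℂ) / (m ! : ℂ) * (-z) ^ m‖ ≤ C * ((B * r) ^ m / m !) := by
    intro r m z hz
    rw [norm_mul, norm_div, norm_pow, norm_neg, Complex.norm_natCast]
    calc _ ≤ C * B ^ m / m ! * r ^ m := by
          have := (norm_nonneg _).trans (hbd m)
          gcongr
          exact hbd m
      _ = _ := by rw [mul_pow]; ring
  have hsum : ∀ r : ℝ, Summable fun m : ℕ => C * ((B * r) ^ m / m !) := fun r =>
    (Real.summable_pow_div_factorial _).mul_left C
  set g : ℂ → ℂ := fun z => ∑' m : ℕ, hbar (m : ℂ) / (m ! : ℂ) * (-z) ^ m with hg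
  have hgd : Differentiable ℂ g := fun z => by
    have := Complex.differentiableOn_tsum_of_summable_norm (hsum (‖z‖ + 1))
      (F := fun (m : ℕ) z => hbar (m : ℂ) / (m ! : ℂ) * (-z) ^ m)
      (U := Metric.ball 0 (‖z‖ + 1)) (fun m => by fun_prop) Metric.isOpen_ball
      (fun m w hw => hle _ m w (by simpa using (Metric.mem_ball.1 hw).le))
    exact this.differentiableAt (Metric.isOpen_ball.mem_nhds (by simp))
  have hpre : IsPreconnected (Complex.ofReal '' Set.Ici 0) :=
    isPreconnected_Ici.image _ Complex.continuous_ofReal.continuousOn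
  have heq := AnalyticOnNhd.eqOn_of_preconnected_of_eventuallyEq (f := h) (g := g) (z₀ := 0)
    (U := Complex.ofReal '' Set.Ici 0) (by rintro _ ⟨y, hy, rfl⟩; exact h_regular y hy)
    (fun z _ => hgd.analyticAt z) hpre ⟨0, by simp⟩
    (h_taylor.mono fun z hz => hz.tsum_eq.symm)
  rw [heq ⟨x, hx, rfl⟩]
  exact (Summable.of_norm_bounded (hsum ‖(x : ℂ)‖) fun m => hle _ m x le_rfl).hasSum

/-- **Ramanujan's master theorem** in Mellin–Barnes form:
`h(x) = (1 / 2π) ∫ hbar(s) Γ(-s) x^s dw` along `s = -δ + iw`. -/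
lemma integral_Gamma_mul_cpow_eq {h hbar : ℂ → ℂ} {δ C P A : ℝ}
    (h_regular : ∀ x : ℝ, 0 ≤ x → AnalyticAt ℂ h (x : ℂ))
    (h_taylor : ∀ᶠ z : ℂ in 𝓝 0,
      HasSum (fun m : ℕ => hbar (m : ℂ) / (m ! : ℂ) * (-z) ^ m) (h z))
    (hδ0 : 0 < δ) (hδ : δ < 1 / 2)
    (hbar_regular : DifferentiableOn ℂ hbar {s : ℂ | -δ ≤ s.re})
    (hA : A < Real.pi / 2)
    (hbar_growth : ∀ s : ℂ, -δ ≤ s.re → ‖hbar s‖ ≤ C * Real.exp (P * s.re + A * |s.im|))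
    {x : ℝ} (hx : 0 < x) :
    ∫ w : ℝ, Complex.Gamma (-((-δ : ℝ) + w * Complex.I)) *
      (hbar ((-δ : ℝ) + w * Complex.I) * (x : ℂ) ^ (((-δ : ℝ) : ℂ) + w * Complex.I)) =
      2 * Real.pi * h x := by
  have hx0 : (x : ℂ) ≠ 0 := by simpa using hx.ne'
  have hC : 0 ≤ C := by
    have := (norm_nonneg _).trans (hbar_growth 0 (by simpa using hδ0.le))
    simpa using this
  have hbd : ∀ s : ℂ, -δ ≤ s.re → ‖hbar s * (x : ℂ) ^ s‖ ≤
      C * Real.exp ((P + Real.log x) * s.re) * Real.exp (A * |s.im|) := by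
    intro s hs
    rw [norm_mul, Complex.norm_cpow_eq_rpow_re_of_pos hx, Real.rpow_def_of_pos hx]
    calc _ ≤ C * Real.exp (P * s.re + A * |s.im|) * Real.exp (Real.log x * s.re) := by
          gcongr
          exact hbar_growth s hs
      _ = _ := by rw [mul_assoc, mul_assoc, ← Real.exp_add, ← Real.exp_add]; ring_nf
  have hF : RegularGrowth δ A fun s => hbar s * (x : ℂ) ^ s := by
    refine ⟨hbar_regular.mul fun s _ =>
      ((differentiableAt_id.const_cpow (Or.inl hx0))).differentiableWithinAt, fun b => ?_⟩
    refine ⟨C * Real.exp (|P + Real.log x| * (|b| + δ)), fun s h1 h2 => (hbd s h1).trans ?_⟩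
    have h3 : |s.re| ≤ |b| + δ := abs_le.2 ⟨by linarith [abs_nonneg b], by linarith [le_abs_self b]⟩
    have h4 : (P + Real.log x) * s.re ≤ |P + Real.log x| * (|b| + δ) :=
      (le_abs_self _).trans (by rw [abs_mul]; gcongr)
    gcongr
  have hlim := tendsto_sum_integral_Gamma_mul hF hδ0 hδ hA
    (C := C * Real.exp ((P + Real.log x) * -δ))
    (B := Real.exp (P + Real.log x)) (Real.exp_pos _).le fun N w => by
      have hN : (0 : ℝ) ≤ N := by positivity
      refine (hbd _ (by simp)).trans (le_of_eq ?_)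
      have e1 : (((-δ : ℝ) : ℂ) + w * Complex.I + N).re = -δ + N := by simp
      have e2 : (((-δ : ℝ) : ℂ) + w * Complex.I + N).im = w := by simp
      have e3 : Real.exp ((P + Real.log x) * (-δ + N)) = Real.exp ((P + Real.log x) * -δ) *
          Real.exp (N * (P + Real.log x)) := by
        rw [← Real.exp_add]
        ring_nf
      rw [e1, e2, e3, ← Real.exp_nat_mul]
      ring
  have hT := hasSum_taylor_of_nonneg (C := C) (B := Real.exp P) h_regular h_taylor
    (fun m => by
      have hm : (0 : ℝ) ≤ m := by positivity
      have := hbar_growth m (by simp; linarith)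
      rw [← Real.exp_nat_mul]
      simpa [mul_comm] using this) hx.le
  refine tendsto_nhds_unique hlim ((hT.tendsto_sum_nat.const_mul (2 * (Real.pi : ℂ))).congr
    fun N => ?_)
  congr 1
  refine Finset.sum_congr rfl fun m _ => ?_
  rw [Complex.cpow_natCast, neg_pow (x : ℂ)]
  ring

/-! ### The Mellin transform of the Bessel function of order one -/

lemma ofReal_cpow_eq_exp {x : ℝ} (hx : 0 < x) (s : ℂ) :
    (x : ℂ) ^ s = Complex.exp (Real.log x * s) := by
  rw [Complex.cpow_def_of_ne_zero (by simpa using hx.ne'), Complex.ofReal_log hx.le]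

lemma integral_pow_mul_exp_neg_mul_sq {p : ℝ} (hp : 0 < p) (m : ℕ) :
    IntegrableOn (fun x : ℝ => x ^ (2 * m + 3) * Real.exp (-p * x ^ 2)) (Set.Ioi 0) ∧
    ∫ x in Set.Ioi (0 : ℝ), x ^ (2 * m + 3) * Real.exp (-p * x ^ 2) =
      (m + 1)! / (2 * p ^ (m + 2)) := by
  have hm : (-1 : ℝ) < (2 * m + 3 : ℕ) := by
    have : (0 : ℝ) ≤ (2 * m + 3 : ℕ) := by positivity
    linarith
  constructor
  · have := (integrable_rpow_mul_exp_neg_mul_sq hp hm).integrableOn (s := Set.Ioi 0)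
    simpa only [Real.rpow_natCast] using this
  · have h := integral_rpow_mul_exp_neg_mul_rpow (p := 2) (q := (2 * m + 3 : ℕ)) two_pos hm hp
    simp only [Real.rpow_natCast, Real.rpow_two] at h
    rw [h]
    have e1 : (((2 * m + 3 : ℕ) : ℝ) + 1) / 2 = ((m + 1 : ℕ) : ℝ) + 1 := by push_cast; ring
    have e2 : -(((2 * m + 3 : ℕ) : ℝ) + 1) / 2 = -((m + 2 : ℕ) : ℝ) := by push_cast; ring
    rw [e1, e2, Real.Gamma_nat_eq_factorial, Real.rpow_neg hp.le, Real.rpow_natCast]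
    field_simp

/-- Weber's integral, obtained by integrating the power series of `J₁` term by term. -/
lemma integral_besselJ1_mul_sq_mul_exp {p : ℝ} (hp : 0 < p) :
    ∫ x in Set.Ioi (0 : ℝ), besselJ1 x * x ^ 2 * Real.exp (-p * x ^ 2) =
      Real.exp (-(1 / 4 * p⁻¹)) / (4 * p ^ 2) := by
  set c : ℕ → ℝ := fun m => (-1) ^ m / ((m ! : ℝ) * ((m + 1)! : ℝ)) / 2 ^ (2 * m + 1) with hc
  have hval : ∀ m : ℕ, |c m| * ((m + 1)! / (2 * p ^ (m + 2))) =
      1 / (4 * p ^ 2) * ((1 / 4 * p⁻¹) ^ m / m !) := fun m => by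
    have h1 : (m ! : ℝ) ≠ 0 := by positivity
    have h2 : ((m + 1)! : ℝ) ≠ 0 := by positivity
    simp only [hc]
    rw [abs_div, abs_div, abs_pow, abs_neg, abs_one, one_pow, abs_of_pos (by positivity),
      abs_of_pos (by positivity), mul_pow, one_div_pow, inv_pow, pow_add, pow_mul]
    norm_num
    field_simp
    ring
  have hint := fun m => integral_pow_mul_exp_neg_mul_sq hp m
  have hsum := hasSum_integral_of_summable_integral_norm (μ := volume.restrict (Set.Ioi (0 : ℝ)))
    (F := fun (m : ℕ) (x : ℝ) => c m * (x ^ (2 * m + 3) * Real.exp (-p * x ^ 2)))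
    (fun m => (hint m).1.const_mul (c m)) (by
      refine ((Real.summable_pow_div_factorial (1 / 4 * p⁻¹)).mul_left (1 / (4 * p ^ 2))).congr
        fun m => ?_
      rw [← hval m, ← (hint m).2, ← integral_const_mul]
      refine setIntegral_congr_fun measurableSet_Ioi fun x hx => ?_
      have : (0 : ℝ) < x := hx
      rw [norm_mul, Real.norm_eq_abs, Real.norm_of_nonneg (by positivity)])
  have hL : ∫ x in Set.Ioi (0 : ℝ), ∑' m, c m * (x ^ (2 * m + 3) * Real.exp (-p * x ^ 2)) =
      ∫ x in Set.Ioi (0 : ℝ), besselJ1 x * x ^ 2 * Real.exp (-p * x ^ 2) := by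
    congr 1
    funext x
    rw [besselJ1, mul_assoc, ← tsum_mul_right]
    refine tsum_congr fun m => ?_
    simp only [hc]
    rw [div_pow]
    ring
  rw [hL] at hsum
  have hterm : ∀ m : ℕ, ∫ x in Set.Ioi (0 : ℝ), c m * (x ^ (2 * m + 3) *
      Real.exp (-p * x ^ 2)) = 1 / (4 * p ^ 2) * ((-(1 / 4 * p⁻¹)) ^ m / m !) := fun m => by
    rw [integral_const_mul, (hint m).2, neg_pow (1 / 4 * p⁻¹), mul_div_assoc, mul_left_comm,
      ← hval m, ← mul_assoc]
    congr 1
    simp only [hc]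
    rw [abs_div, abs_div, abs_pow, abs_neg, abs_one, one_pow, abs_of_pos (by positivity),
      abs_of_pos (by positivity)]
    ring
  have hexp : HasSum (fun m : ℕ => (-(1 / 4 * p⁻¹)) ^ m / m !) (Real.exp (-(1 / 4 * p⁻¹))) := by
    rw [Real.exp_eq_exp_ℝ]
    exact NormedSpace.expSeries_div_hasSum_exp _
  simp only [hterm] at hsum
  exact (hsum.unique (hexp.mul_left (1 / (4 * p ^ 2)))).trans (by ring)

lemma mellinConvergent_besselJ1 {s : ℂ} (h0 : -1 / 2 < s.re) (h1 : s.re < -1 / 8) {q : ℝ}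
    (hq : 0 < q) : MellinConvergent (fun x => (besselJ1 (q * x) : ℂ)) (4 * s + 1) := by
  have h := mellinConvergent_of_isBigO_rpow (f := fun x => (besselJ1 x : ℂ)) (a := 1 / 2)
    (b := -1) (s := 4 * s + 1)
    ((Complex.continuous_ofReal.comp continuous_besselJ1).locallyIntegrable.locallyIntegrableOn _)
    (by simpa using besselJ1_isBigO_atTop) (by simp; linarith)
    (by simpa using besselJ1_isBigO_nhds_zero) (by simp; linarith)
  exact (MellinConvergent.comp_mul_left (f := fun x => (besselJ1 x : ℂ)) hq).2 h

lemma integrableOn_cpow_mul_besselJ1 {s : ℂ} (h0 : -1 / 2 < s.re) (h1 : s.re < -1 / 8) {q : ℝ}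
    (hq : 0 < q) :
    IntegrableOn (fun x : ℝ => (x : ℂ) ^ (4 * s) * (besselJ1 (q * x) : ℂ)) (Set.Ioi 0) := by
  have := mellinConvergent_besselJ1 h0 h1 hq
  simpa [MellinConvergent] using this

lemma integral_cpow_mul_exp_div_sq {s : ℂ} (h0 : -1 / 2 < s.re) :
    ∫ p in Set.Ioi (0 : ℝ), (p : ℂ) ^ (-(2 * s)) *
      ((Real.exp (-(1 / 4 * p⁻¹)) / (4 * p ^ 2) : ℝ) : ℂ) =
      (4 : ℂ) ^ (2 * s) * Complex.Gamma (2 * s + 1) := by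
  have h := mellin_comp_inv (fun t : ℝ => ((Real.exp (-(1 / 4 * t)) : ℝ) : ℂ)) (-(2 * s + 1))
  rw [neg_neg] at h
  simp only [mellin, smul_eq_mul] at h
  have h2 := Complex.integral_cpow_mul_exp_neg_mul_Ioi (a := 2 * s + 1) (r := 1 / 4)
    (by simp; linarith) (by norm_num)
  push_cast at h h2
  rw [h2] at h
  have e4 : (4 : ℂ) ^ (2 * s + 1) = 4 ^ (2 * s) * 4 := by
    rw [Complex.cpow_add _ _ (by norm_num), Complex.cpow_one]
  rw [one_div_one_div, e4] at h
  have e : ∀ p ∈ Set.Ioi (0 : ℝ), (p : ℂ) ^ (-(2 * s)) *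
      ((Real.exp (-(1 / 4 * p⁻¹)) / (4 * p ^ 2) : ℝ) : ℂ) =
      1 / 4 * ((p : ℂ) ^ (-(2 * s + 1) - 1) * Complex.exp (-(1 / 4 * (p : ℂ)⁻¹))) := by
    intro p hp
    have hp0 : (p : ℂ) ≠ 0 := by simpa using (ne_of_gt hp)
    have e1 : (p : ℂ) ^ (-(2 * s)) = (p : ℂ) ^ (-(2 * s + 1) - 1) * (p : ℂ) ^ 2 := by
      rw [← Complex.cpow_natCast, ← Complex.cpow_add _ _ hp0]
      congr 1
      push_cast
      ring
    rw [e1]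
    push_cast
    field_simp
  rw [setIntegral_congr_fun measurableSet_Ioi e, integral_const_mul, h]
  ring

/-- The Mellin transform of `J₁`. It comes from Weber's integral by writing `Γ(1 - 2s) x^(4s - 2)`
as `∫ p^(-2s) e^(-p x²) dp` and exchanging the integrations. -/
lemma Gamma_mul_integral_cpow_mul_besselJ1 {s : ℂ} (h0 : -1 / 2 < s.re) (h1 : s.re < -1 / 8) :
    Complex.Gamma (1 - 2 * s) * ∫ x in Set.Ioi (0 : ℝ), (x : ℂ) ^ (4 * s) * (besselJ1 x : ℂ) =
      (4 : ℂ) ^ (2 * s) * Complex.Gamma (2 * s + 1) := by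
  set μ := volume.restrict (Set.Ioi (0 : ℝ)) with hμ
  set k : ℝ → ℝ → ℂ := fun x p => (p : ℂ) ^ (-(2 * s)) *
    ((besselJ1 x * x ^ 2 * Real.exp (-p * x ^ 2) : ℝ) : ℂ) with hk
  have hmeas : Measurable (Function.uncurry k) := by
    have hJ := continuous_besselJ1.measurable
    refine Measurable.mul ?_ ?_
    · exact (Complex.measurable_ofReal.comp measurable_snd).pow_const _
    · exact Complex.measurable_ofReal.comp (((hJ.comp measurable_fst).mul
        (measurable_fst.pow_const 2)).mul
        (Real.measurable_exp.comp (measurable_snd.neg.mul (measurable_fst.pow_const 2))))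
  have hnorm : ∀ x ∈ Set.Ioi (0 : ℝ), ∀ p ∈ Set.Ioi (0 : ℝ), ‖k x p‖ = |besselJ1 x| * x ^ 2 *
      (p ^ ((1 - 2 * s.re) - 1) * Real.exp (-(x ^ 2 * p))) := by
    intro x hx p hp
    simp only [hk]
    rw [norm_mul, Complex.norm_cpow_eq_rpow_re_of_pos hp, Complex.norm_real, norm_mul, norm_mul,
      Real.norm_eq_abs, Real.norm_of_nonneg (sq_nonneg x), Real.norm_of_nonneg (Real.exp_pos _).le]
    have e1 : (-(2 * s)).re = (1 - 2 * s.re) - 1 := by simp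
    rw [e1, neg_mul, mul_comm p]
    ring
  have hr : ∀ x ∈ Set.Ioi (0 : ℝ), IntegrableOn
      (fun p : ℝ => p ^ ((1 - 2 * s.re) - 1) * Real.exp (-(x ^ 2 * p))) (Set.Ioi 0) := by
    intro x hx
    have hx' : (0 : ℝ) < x := hx
    have := integrableOn_rpow_mul_exp_neg_mul_rpow (p := 1) (s := (1 - 2 * s.re) - 1)
      (b := x ^ 2) (by linarith) one_pos (by positivity)
    simpa using this
  have hint : Integrable (Function.uncurry k) (μ.prod μ) := by
    rw [integrable_prod_iff hmeas.aestronglyMeasurable]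
    constructor
    · filter_upwards [ae_restrict_mem measurableSet_Ioi] with x hx
      refine Integrable.mono' ((hr x hx).const_mul (|besselJ1 x| * x ^ 2))
        (hmeas.comp measurable_prodMk_left).aestronglyMeasurable ?_
      filter_upwards [ae_restrict_mem measurableSet_Ioi] with p hp
      exact (hnorm x hx p hp).le
    · have hM := (integrableOn_cpow_mul_besselJ1 h0 h1 one_pos).norm.mul_const
        (Real.Gamma (1 - 2 * s.re))
      refine hM.congr ?_
      filter_upwards [ae_restrict_mem measurableSet_Ioi] with x hx
      have hx' : (0 : ℝ) < x := hx
      simp only [Function.uncurry_apply_pair]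
      rw [setIntegral_congr_fun (g := fun p => |besselJ1 x| * x ^ 2 *
        (p ^ ((1 - 2 * s.re) - 1) * Real.exp (-(x ^ 2 * p)))) measurableSet_Ioi
        (fun p hp => hnorm x hx p hp), integral_const_mul,
        Real.integral_rpow_mul_exp_neg_mul_Ioi (by linarith) (by positivity), norm_mul,
        Complex.norm_cpow_eq_rpow_re_of_pos hx', Complex.norm_real, one_mul, Real.norm_eq_abs]
      have e1 : (4 * s).re = 4 * s.re := by simp
      have e2 : x ^ (4 * s.re) = x ^ 2 * (1 / x ^ 2) ^ (1 - 2 * s.re) := by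
        rw [one_div, Real.inv_rpow (by positivity), ← Real.rpow_natCast, ← Real.rpow_mul hx'.le,
          ← Real.rpow_neg hx'.le, ← Real.rpow_add hx']
        congr 1
        push_cast
        ring
      rw [e1, e2]
      ring
  have hswap := integral_integral_swap hint
  have hleft : ∀ x ∈ Set.Ioi (0 : ℝ), ∫ p, k x p ∂μ =
      Complex.Gamma (1 - 2 * s) * ((x : ℂ) ^ (4 * s) * (besselJ1 x : ℂ)) := by
    intro x hx
    have hx' : (0 : ℝ) < x := hx
    have h := Complex.integral_cpow_mul_exp_neg_mul_Ioi (a := 1 - 2 * s) (r := x ^ 2)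
      (by simp; linarith) (by positivity)
    have e1 : ∀ p : ℝ, k x p = (besselJ1 x : ℂ) * (x : ℂ) ^ 2 *
        ((p : ℂ) ^ (1 - 2 * s - 1) * Complex.exp (-(((x ^ 2 : ℝ) : ℂ) * p))) := fun p => by
      have : -(2 * s) = 1 - 2 * s - 1 := by ring
      simp only [hk]
      rw [this]
      push_cast
      rw [neg_mul, mul_comm (p : ℂ) ((x : ℂ) ^ 2)]
      ring
    simp only [e1]
    rw [integral_const_mul, h, ← Complex.ofReal_one, ← Complex.ofReal_div,
      ofReal_cpow_eq_exp (by positivity), ofReal_cpow_eq_exp hx', one_div, Real.log_inv,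
      Real.log_pow]
    have e2 : (x : ℂ) ^ 2 = Complex.exp (Real.log x * 2) := by
      rw [← ofReal_cpow_eq_exp hx']
      norm_num
    rw [e2, Complex.ofReal_one]
    have e3 : Complex.exp (Real.log x * 2) *
        Complex.exp (((-((2 : ℕ) * Real.log x) : ℝ) : ℂ) * (1 - 2 * s)) =
        Complex.exp (Real.log x * (4 * s)) := by
      rw [← Complex.exp_add]
      congr 1
      push_cast
      ring
    rw [← e3]
    ring
  have hright : ∀ p ∈ Set.Ioi (0 : ℝ), ∫ x, k x p ∂μ = (p : ℂ) ^ (-(2 * s)) *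
      ((Real.exp (-(1 / 4 * p⁻¹)) / (4 * p ^ 2) : ℝ) : ℂ) := by
    intro p hp
    simp only [hk]
    rw [integral_const_mul, integral_complex_ofReal, integral_besselJ1_mul_sq_mul_exp hp]
  rw [setIntegral_congr_fun measurableSet_Ioi hleft,
    setIntegral_congr_fun measurableSet_Ioi hright, integral_const_mul,
    integral_cpow_mul_exp_div_sq h0] at hswap
  exact hswap

/-! ### The truncated Mellin transform of the Bessel function of order zero -/

/-- The kernel `∫₀^R J₀(q x) x^(4s) x dx` of the truncated Hankel transform of `x ↦ (x⁴)^s`. -/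
noncomputable def hankelKernel (q R : ℝ) (s : ℂ) : ℂ :=
  ∫ x in (0 : ℝ)..R, (besselJ0 (q * x) : ℂ) * (x : ℂ) ^ (4 * s) * x

lemma intervalIntegrable_mul_cpow_mul {g : ℝ → ℝ} (hg : Continuous g) {s : ℂ}
    (h0 : -1 / 2 < s.re) (R : ℝ) :
    IntervalIntegrable (fun x : ℝ => (g x : ℂ) * (x : ℂ) ^ (4 * s) * x) volume 0 R := by
  have h1 : IntervalIntegrable (fun x : ℝ => (x : ℂ) ^ (4 * s + 1)) volume 0 R :=
    intervalIntegral.intervalIntegrable_cpow' (by simp; linarith)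
  have hg' : Continuous fun x : ℝ => (g x : ℂ) := Complex.continuous_ofReal.comp hg
  refine (h1.continuousOn_mul hg'.continuousOn).congr_ae ?_
  have h2 : ∀ᵐ x : ℝ, x ≠ 0 := by simp [ae_iff]
  filter_upwards [ae_restrict_of_ae h2] with x hx
  rw [Complex.cpow_add _ _ (by simpa using hx), Complex.cpow_one, mul_assoc]

/-- Integration by parts with `(x J₁(q x))' = q x J₀(q x)`. -/
lemma hankelKernel_eq {q R : ℝ} (hq : 0 < q) (hR : 0 < R) {s : ℂ} (h0 : -1 / 2 < s.re)
    (h1 : s.re < -1 / 8) :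
    hankelKernel q R s = (1 / q) * ((R * besselJ1 (q * R) : ℝ) * (R : ℂ) ^ (4 * s) -
      4 * s * ∫ x in (0 : ℝ)..R, (x : ℂ) ^ (4 * s) * (besselJ1 (q * x) : ℂ)) := by
  have hq0 : (q : ℂ) ≠ 0 := by simpa using hq.ne'
  -- The boundary term `u` tends to `0` at `0`, because `J₁(x) = O(x)` and `Re (4 s) > -2`.
  set u : ℝ → ℂ := fun x => ((x * besselJ1 (q * x) : ℝ) : ℂ) * (x : ℂ) ^ (4 * s) with hu
  have hJ0 : Continuous fun x => besselJ0 (q * x) :=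
    continuous_besselJ0.comp (continuous_const_mul q)
  have hI0 := (intervalIntegrable_mul_cpow_mul hJ0 h0 R).const_mul (q : ℂ)
  have hI1 : IntervalIntegrable (fun x : ℝ => (x : ℂ) ^ (4 * s) * (besselJ1 (q * x) : ℂ))
      volume 0 R :=
    (intervalIntegrable_iff_integrableOn_Ioc_of_le hR.le).2
      ((integrableOn_cpow_mul_besselJ1 h0 h1 hq).mono_set Set.Ioc_subset_Ioi_self)
  have hderiv : ∀ x ∈ Set.Ioo 0 R, HasDerivAt u
      (q * ((besselJ0 (q * x) : ℂ) * (x : ℂ) ^ (4 * s) * x) +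
        4 * s * ((x : ℂ) ^ (4 * s) * (besselJ1 (q * x) : ℂ))) x := by
    intro x hx
    have hx0 : (x : ℂ) ≠ 0 := by simpa using hx.1.ne'
    have d1 : HasDerivAt (fun x => x * besselJ1 (q * x)) (q * x * besselJ0 (q * x)) x := by
      have h := ((hasDerivAt_mul_besselJ1 (q * x)).comp x
        (hasDerivAt_const_mul q)).const_mul (1 / q)
      have e : (fun y => 1 / q * ((fun x => x * besselJ1 x) ∘ HMul.hMul q) y) =
          fun x => x * besselJ1 (q * x) := by
        funext y
        simp only [Function.comp_apply]
        field_simp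
      rw [e] at h
      refine h.congr_deriv ?_
      field_simp
    have hs0 : 4 * s ≠ 0 := fun h => by
      have := congrArg Complex.re h
      simp at this
      linarith
    have d2 := hasDerivAt_ofReal_cpow_const (x := x) hx.1.ne' hs0
    refine (d1.ofReal_comp.mul d2).congr_deriv ?_
    have e : (x : ℂ) ^ (4 * s) = (x : ℂ) ^ (4 * s - 1) * x := by
      rw [Complex.cpow_sub _ _ hx0, Complex.cpow_one, div_mul_cancel₀ _ hx0]
    rw [e]
    push_cast
    ring
  have hlim0 : Tendsto u (𝓝[>] 0) (𝓝 0) := by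
    have hO : (fun x => besselJ1 (q * x)) =O[𝓝[>] 0] fun x : ℝ => x := by
      have ht : Tendsto (fun x : ℝ => q * x) (𝓝[>] 0) (𝓝[>] 0) := by
        refine tendsto_nhdsWithin_iff.2 ⟨?_, ?_⟩
        · have h := (continuous_const_mul q).tendsto 0
          rw [mul_zero] at h
          exact h.mono_left nhdsWithin_le_nhds
        · filter_upwards [self_mem_nhdsWithin] with x hx
          exact mul_pos hq hx
      have h := besselJ1_isBigO_nhds_zero.comp_tendsto ht
      simp only [neg_neg, Real.rpow_one, Function.comp_def] at h
      exact h.trans (Asymptotics.isBigO_const_mul_self q _ _)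
    obtain ⟨c, hc'⟩ := hO.bound
    have hz : Tendsto (fun x : ℝ => c * x ^ (2 + 4 * s.re)) (𝓝[>] 0) (𝓝 0) := by
      have : ContinuousAt (fun x : ℝ => c * x ^ (2 + 4 * s.re)) 0 :=
        continuousAt_const.mul (Real.continuousAt_rpow_const _ _ (Or.inr (by linarith)))
      have h2 := this.tendsto
      rw [Real.zero_rpow (by linarith), mul_zero] at h2
      exact h2.mono_left nhdsWithin_le_nhds
    refine squeeze_zero_norm' ?_ hz
    filter_upwards [hc', self_mem_nhdsWithin] with x hx hx0
    have hx0' : (0 : ℝ) < x := hx0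
    have e1 : (4 * s).re = 4 * s.re := by simp
    rw [Real.norm_eq_abs, Real.norm_of_nonneg hx0'.le] at hx
    simp only [hu]
    rw [norm_mul, Complex.norm_cpow_eq_rpow_re_of_pos hx0', Complex.norm_real, norm_mul, e1,
      Real.norm_of_nonneg hx0'.le, Real.norm_eq_abs, Real.rpow_add hx0', Real.rpow_two]
    calc _ ≤ x * (c * x) * x ^ (4 * s.re) := by gcongr
      _ = _ := by ring
  have hlimR : Tendsto u (𝓝[<] R) (𝓝 (u R)) := by
    have : ContinuousAt u R := by
      refine ContinuousAt.mul (Complex.continuous_ofReal.comp (continuous_id.mul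
        (continuous_besselJ1.comp (continuous_const.mul continuous_id)))).continuousAt ?_
      exact (Complex.continuousAt_ofReal_cpow_const R _ (Or.inr hR.ne'))
    exact this.tendsto.mono_left nhdsWithin_le_nhds
  have key := intervalIntegral.integral_eq_sub_of_hasDerivAt_of_tendsto hR hderiv
    (hI0.add (hI1.const_mul (4 * s))) hlim0 hlimR
  rw [intervalIntegral.integral_add hI0 (hI1.const_mul _), intervalIntegral.integral_const_mul,
    intervalIntegral.integral_const_mul] at key
  have e : hankelKernel q R s = 1 / q * (q * hankelKernel q R s) := by field_simp
  rw [e]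
  congr 1
  rw [hankelKernel]
  simp only [hu] at key
  linear_combination key

lemma tendsto_mul_besselJ1_mul_rpow {q c : ℝ} (hq : 0 < q) (hc : c < -1 / 2) :
    Tendsto (fun R : ℝ => R * |besselJ1 (q * R)| * R ^ c) atTop (𝓝 0) := by
  have ht : Tendsto (fun x : ℝ => q * x) atTop atTop := tendsto_id.const_mul_atTop hq
  obtain ⟨K, hK⟩ := (besselJ1_isBigO_atTop.comp_tendsto ht).bound
  have hz : Tendsto (fun R : ℝ => K * q ^ (-(1 / 2) : ℝ) * R ^ (-(-1 / 2 - c))) atTop (𝓝 0) := by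
    simpa using (tendsto_rpow_neg_atTop (y := -1 / 2 - c) (by linarith)).const_mul
      (K * q ^ (-(1 / 2) : ℝ))
  refine squeeze_zero_norm' ?_ hz
  filter_upwards [hK, eventually_gt_atTop 0] with R hR hR0
  simp only [Function.comp_apply] at hR
  rw [Real.norm_eq_abs, Real.norm_of_nonneg (by positivity), Real.mul_rpow hq.le hR0.le] at hR
  rw [Real.norm_of_nonneg (by positivity)]
  have e : R ^ (-(-1 / 2 - c)) = R * R ^ (-(1 / 2) : ℝ) * R ^ c := by
    nth_rewrite 2 [← Real.rpow_one R]
    rw [← Real.rpow_add hR0, ← Real.rpow_add hR0]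
    congr 1
    ring
  rw [e]
  calc _ ≤ R * (K * (q ^ (-(1 / 2) : ℝ) * R ^ (-(1 / 2) : ℝ))) * R ^ c := by gcongr
    _ = _ := by ring

lemma integral_cpow_mul_besselJ1_mul {s : ℂ} (h0 : -1 / 2 < s.re) (h1 : s.re < -1 / 8) {q : ℝ}
    (hq : 0 < q) :
    ∫ x in Set.Ioi (0 : ℝ), (x : ℂ) ^ (4 * s) * (besselJ1 (q * x) : ℂ) =
      (q : ℂ) ^ (-(4 * s + 1)) * ((4 : ℂ) ^ (2 * s) * Complex.Gamma (2 * s + 1) /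
        Complex.Gamma (1 - 2 * s)) := by
  have h := mellin_comp_mul_left (fun x => (besselJ1 x : ℂ)) (4 * s + 1) hq
  simp only [mellin, add_sub_cancel_right, smul_eq_mul] at h
  have hG : Complex.Gamma (1 - 2 * s) ≠ 0 :=
    Complex.Gamma_ne_zero_of_re_pos (by simp; linarith)
  rw [h, ← Gamma_mul_integral_cpow_mul_besselJ1 h0 h1, mul_div_cancel_left₀ _ hG]

/-- The Mellin transform of `J₀`, as a conditionally convergent integral. -/
lemma tendsto_hankelKernel {q : ℝ} (hq : 0 < q) {s : ℂ} (h0 : -1 / 2 < s.re)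
    (h1 : s.re < -1 / 8) :
    Tendsto (fun R => hankelKernel q R s) atTop (𝓝 (-(4 * s / q) * ((q : ℂ) ^ (-(4 * s + 1)) *
      ((4 : ℂ) ^ (2 * s) * Complex.Gamma (2 * s + 1) / Complex.Gamma (1 - 2 * s))))) := by
  have hb : Tendsto (fun R : ℝ => ((R * besselJ1 (q * R) : ℝ) : ℂ) * (R : ℂ) ^ (4 * s)) atTop
      (𝓝 0) := by
    rw [tendsto_zero_iff_norm_tendsto_zero]
    refine (tendsto_mul_besselJ1_mul_rpow (c := 4 * s.re) hq (by linarith)).congr' ?_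
    filter_upwards [eventually_gt_atTop 0] with R hR
    rw [norm_mul, Complex.norm_real, norm_mul, Real.norm_of_nonneg hR.le, Real.norm_eq_abs,
      Complex.norm_cpow_eq_rpow_re_of_pos hR]
    simp
  have hi := intervalIntegral_tendsto_integral_Ioi 0 (integrableOn_cpow_mul_besselJ1 h0 h1 hq)
    tendsto_id
  have h := ((hb.sub (hi.const_mul (4 * s))).const_mul (1 / (q : ℂ)))
  rw [integral_cpow_mul_besselJ1_mul h0 h1 hq] at h
  have e : -(4 * s / q) * ((q : ℂ) ^ (-(4 * s + 1)) *
      ((4 : ℂ) ^ (2 * s) * Complex.Gamma (2 * s + 1) / Complex.Gamma (1 - 2 * s))) =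
      1 / q * (0 - 4 * s * ((q : ℂ) ^ (-(4 * s + 1)) *
      ((4 : ℂ) ^ (2 * s) * Complex.Gamma (2 * s + 1) / Complex.Gamma (1 - 2 * s)))) := by ring
  rw [e]
  refine h.congr' ?_
  filter_upwards [eventually_gt_atTop 0] with R hR
  exact (hankelKernel_eq hq hR h0 h1).symm

/-- A bound for the kernel on a vertical line that is uniform in the truncation `R`. -/
lemma exists_norm_hankelKernel_le {q δ : ℝ} (hq : 0 < q) (h0 : 1 / 8 < δ) (h1 : δ < 1 / 2) :
    ∃ M : ℝ, 0 ≤ M ∧ ∀ᶠ R : ℝ in atTop, ∀ w : ℝ,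
      ‖hankelKernel q R ((-δ : ℝ) + w * Complex.I)‖ ≤ M * (1 + |w|) := by
  set N : ℝ := ∫ x in Set.Ioi (0 : ℝ), ‖(x : ℂ) ^ (4 * ((-δ : ℝ) : ℂ)) * (besselJ1 (q * x) : ℂ)‖
    with hN
  have hN0 : 0 ≤ N := integral_nonneg fun x => norm_nonneg _
  have hpt : ∀ x ∈ Set.Ioi (0 : ℝ), ∀ w : ℝ,
      ‖(x : ℂ) ^ (4 * (((-δ : ℝ) : ℂ) + w * Complex.I)) * (besselJ1 (q * x) : ℂ)‖ =
      ‖(x : ℂ) ^ (4 * ((-δ : ℝ) : ℂ)) * (besselJ1 (q * x) : ℂ)‖ := by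
    intro x hx w
    rw [norm_mul, norm_mul, Complex.norm_cpow_eq_rpow_re_of_pos hx,
      Complex.norm_cpow_eq_rpow_re_of_pos hx]
    simp
  refine ⟨1 / q * (1 + 4 * N), by positivity, ?_⟩
  have hev := (tendsto_mul_besselJ1_mul_rpow (c := 4 * -δ) hq (by linarith)).eventually
    (ge_mem_nhds zero_lt_one)
  filter_upwards [hev, eventually_gt_atTop 0] with R hR hR0 w
  set s : ℂ := (-δ : ℝ) + w * Complex.I with hs
  have hsre : s.re = -δ := by simp [hs]
  have hsn : ‖s‖ ≤ 1 + |w| := by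
    refine (norm_add_le _ _).trans ?_
    rw [norm_mul, Complex.norm_I, Complex.norm_real, Complex.norm_real, Real.norm_eq_abs,
      Real.norm_eq_abs, abs_neg, abs_of_pos (by linarith)]
    linarith
  have hA : ‖((R * besselJ1 (q * R) : ℝ) : ℂ) * (R : ℂ) ^ (4 * s)‖ ≤ 1 := by
    rw [norm_mul, Complex.norm_real, norm_mul, Real.norm_of_nonneg hR0.le, Real.norm_eq_abs,
      Complex.norm_cpow_eq_rpow_re_of_pos hR0]
    have e : (4 * s).re = 4 * -δ := by simp [hsre]
    rwa [e]
  have hB : ‖∫ x in (0 : ℝ)..R, (x : ℂ) ^ (4 * s) * (besselJ1 (q * x) : ℂ)‖ ≤ N := by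
    refine (intervalIntegral.norm_integral_le_integral_norm hR0.le).trans ?_
    rw [intervalIntegral.integral_of_le hR0.le,
      setIntegral_congr_fun measurableSet_Ioc fun x hx => hpt x hx.1 w]
    exact setIntegral_mono_set (integrableOn_cpow_mul_besselJ1 (s := ((-δ : ℝ) : ℂ))
      (by simp; linarith) (by simp; linarith) hq).norm
      (Eventually.of_forall fun x => norm_nonneg _) Set.Ioc_subset_Ioi_self.eventuallyLE
  rw [hankelKernel_eq hq hR0 (by rw [hsre]; linarith) (by rw [hsre]; linarith), norm_mul, norm_div,
    norm_one, Complex.norm_real, Real.norm_of_nonneg hq.le, mul_assoc (1 / q)]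
  gcongr
  refine (norm_sub_le _ _).trans ?_
  rw [norm_mul (4 * s), norm_mul 4, Complex.norm_ofNat]
  calc _ ≤ 1 + 4 * (1 + |w|) * N := by gcongr
    _ ≤ _ := by nlinarith [abs_nonneg w]

/-! ### The Hankel transform -/

/-- By Legendre's duplication formula, the Mellin–Barnes integrand for `h` times the Mellin
transform of `J₀` is the integrand of the Hankel transform. -/
lemma Gamma_mul_mellin_eq_hankelMellinIntegrand (hbar : ℂ → ℂ) {q : ℝ} (hq : 0 < q) {s : ℂ}
    (h0 : -1 / 2 < s.re) (h1 : s.re < 0) :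
    Complex.Gamma (-s) * hbar s * (-(4 * s / q) * ((q : ℂ) ^ (-(4 * s + 1)) *
      ((4 : ℂ) ^ (2 * s) * Complex.Gamma (2 * s + 1) / Complex.Gamma (1 - 2 * s)))) =
      2 * Real.pi * (1 / ((q : ℂ) ^ 2 * (Real.sqrt Real.pi : ℂ)) *
        hankelMellinIntegrand hbar q s) := by
  have hq0 : (q : ℂ) ≠ 0 := by simpa using hq.ne'
  have hs0 : s ≠ 0 := fun h => by simp [h] at h1
  have hpi : (Real.sqrt Real.pi : ℂ) ≠ 0 := by
    simpa using (Real.sqrt_pos.2 Real.pi_pos).ne'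
  have hpi2 : (Real.pi : ℂ) = (Real.sqrt Real.pi : ℂ) * (Real.sqrt Real.pi : ℂ) := by
    rw [← Complex.ofReal_mul, Real.mul_self_sqrt Real.pi_pos.le]
  have hG1 : Complex.Gamma (1 - 2 * s) ≠ 0 :=
    Complex.Gamma_ne_zero_of_re_pos (by simp; linarith)
  have hG2 : Complex.Gamma (1 / 2 - s) ≠ 0 :=
    Complex.Gamma_ne_zero_of_re_pos (by simp; linarith)
  have hdup := Complex.Gamma_mul_Gamma_add_half (1 / 2 - s)
  have e1 : (1 : ℂ) / 2 - s + 1 / 2 = -s + 1 := by ring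
  have e2 : (2 : ℂ) * (1 / 2 - s) = 1 - 2 * s := by ring
  have e3 : (1 : ℂ) - (1 - 2 * s) = 2 * s := by ring
  rw [e1, e2, e3, Complex.Gamma_add_one _ (neg_ne_zero.2 hs0)] at hdup
  have e4 : (4 : ℂ) ^ (2 * s) = (2 : ℂ) ^ (4 * s) := by
    have h4 := ofReal_cpow_eq_exp (x := 4) (by norm_num) (2 * s)
    have h2 := ofReal_cpow_eq_exp (x := 2) (by norm_num) (4 * s)
    have hl : Real.log 4 = 2 * Real.log 2 := by
      rw [show (4 : ℝ) = 2 ^ 2 by norm_num, Real.log_pow]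
      norm_num
    rw [Complex.ofReal_ofNat] at h4 h2
    rw [h4, h2, hl]
    congr 1
    push_cast
    ring
  have e5 : (2 : ℂ) ^ (6 * s + 1) = (2 : ℂ) ^ (4 * s) * (2 : ℂ) ^ (2 * s) * 2 := by
    rw [← Complex.cpow_add _ _ two_ne_zero, Complex.cpow_add _ _ two_ne_zero, Complex.cpow_one]
    ring_nf
  have e6 : (q : ℂ) ^ (-(4 * s + 1)) = (q : ℂ) ^ (-4 * s) * (q : ℂ)⁻¹ := by
    rw [← Complex.cpow_neg_one, ← Complex.cpow_add _ _ hq0]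
    ring_nf
  have e7 : Complex.Gamma (-s) * -s / Complex.Gamma (1 - 2 * s) =
      (2 : ℂ) ^ (2 * s) * (Real.sqrt Real.pi : ℂ) / Complex.Gamma (1 / 2 - s) := by
    rw [div_eq_div_iff hG1 hG2]
    linear_combination hdup
  rw [hankelMellinIntegrand, e4, e5, e6]
  calc _ = Complex.Gamma (-s) * -s / Complex.Gamma (1 - 2 * s) * (4 * hbar s *
        ((q : ℂ) ^ (-4 * s) * (q : ℂ)⁻¹ ^ 2) * (2 : ℂ) ^ (4 * s) * Complex.Gamma (2 * s + 1)) := by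
        field_simp
    _ = _ := by
        rw [e7, hpi2]
        field_simp
        ring

lemma differentiableOn_hankelMellinIntegrand {hbar : ℂ → ℂ} {δ : ℝ} (hδ : δ < 1 / 2)
    (hbar_regular : DifferentiableOn ℂ hbar {s : ℂ | -δ ≤ s.re}) {q : ℝ} (hq : 0 < q) :
    DifferentiableOn ℂ (hankelMellinIntegrand hbar q) {s : ℂ | -δ ≤ s.re} := by
  have hq0 : (q : ℂ) ≠ 0 := by simpa using hq.ne'
  have h2 : DifferentiableOn ℂ (fun s => Complex.Gamma (2 * s + 1)) {s : ℂ | -δ ≤ s.re} := by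
    intro s hs
    refine ((Complex.differentiableAt_Gamma (2 * s + 1) fun m h => ?_).comp s
      (by fun_prop)).differentiableWithinAt
    have h1 := congrArg Complex.re h
    have h2 : -δ ≤ s.re := hs
    have : (0 : ℝ) ≤ m := by positivity
    simp at h1
    linarith
  have h3 : DifferentiableOn ℂ (fun s => (Complex.Gamma (1 / 2 - s))⁻¹) {s : ℂ | -δ ≤ s.re} :=
    (Complex.differentiable_one_div_Gamma.comp
      (by fun_prop : Differentiable ℂ fun s : ℂ => 1 / 2 - s)).differentiableOn
  have h4 : Differentiable ℂ fun s : ℂ => (2 : ℂ) ^ (6 * s + 1) := fun s =>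
    (by fun_prop : DifferentiableAt ℂ (fun s : ℂ => 6 * s + 1) s).const_cpow (Or.inl two_ne_zero)
  have h5 : Differentiable ℂ fun s : ℂ => (q : ℂ) ^ (-4 * s) := fun s =>
    (by fun_prop : DifferentiableAt ℂ (fun s : ℂ => -4 * s) s).const_cpow (Or.inl hq0)
  exact (((hbar_regular.mul (h2.mul h3)).mul h4.differentiableOn).mul h5.differentiableOn)

/-- The integrand is `O((1 + |w|) e^{(A - π/2)|w|})`: the decay `e^{-π|w|}` of `Γ(2s + 1)` outweighs
the growth `e^{π|w|/2}` of `1 / Γ(1/2 - s)` and `e^{A|w|}` of `hbar`. -/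
lemma exists_norm_hankelMellinIntegrand_le {hbar : ℂ → ℂ} {δ α C P A : ℝ} (hδ : δ < 1 / 2)
    (hδ0 : 0 < δ) (hα' : α < 0) (hA : A < Real.pi / 2)
    (hbar_growth : ∀ s : ℂ, -δ ≤ s.re → ‖hbar s‖ ≤ C * Real.exp (P * s.re + A * |s.im|))
    {q : ℝ} (hq : 0 < q) :
    ∃ K : ℝ, ∀ s : ℂ, -δ ≤ s.re → s.re ≤ α → 1 ≤ |s.im| →
      ‖hankelMellinIntegrand hbar q s‖ ≤ K / s.im ^ 2 := by
  obtain ⟨K1, hK1, hG1⟩ := exists_norm_Gamma_le (a := 1 - 2 * δ) (b := 2 * α + 1)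
    (by linarith) (by linarith)
  obtain ⟨K2, hK2, hG2⟩ := exists_norm_inv_Gamma_le (a := 1 / 2 - α) (b := 1 / 2 + δ) (by linarith)
  obtain ⟨K3, hK3, hE⟩ := exists_pow_mul_exp_neg_le (sub_pos.2 hA)
  have hC : 0 ≤ C := by
    have := (norm_nonneg _).trans (hbar_growth 0 (by simpa using hδ0.le))
    simpa using this
  refine ⟨C * Real.exp (|P| * δ) * K1 * K2 * 2 * Real.exp (|Real.log q| * (4 * δ)) * 2 * K3,
    fun s h1 h2 h3 => ?_⟩
  set t : ℝ := |s.im| with ht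
  have hσ : |s.re| ≤ δ := abs_le.2 ⟨h1, by linarith⟩
  have b1 : ‖hbar s‖ ≤ C * Real.exp (|P| * δ) * Real.exp (A * t) := by
    refine (hbar_growth s h1).trans ?_
    rw [Real.exp_add, ← mul_assoc]
    have : P * s.re ≤ |P| * δ := (le_abs_self _).trans (by rw [abs_mul]; gcongr)
    gcongr
  have b2 : ‖Complex.Gamma (2 * s + 1)‖ ≤
      K1 * (2 * (1 + t) * Real.exp (-(Real.pi * t))) := by
    have h := hG1 (2 * s + 1) (by simp; linarith) (by simp; linarith)
    have e : |(2 * s + 1).im| = 2 * t := by simp [ht, abs_mul]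
    rw [e] at h
    refine h.trans ?_
    have e2 : Real.pi / 2 * (2 * t) = Real.pi * t := by ring
    rw [e2]
    gcongr
    linarith
  have b3 : ‖(Complex.Gamma (1 / 2 - s))⁻¹‖ ≤ K2 * Real.exp (Real.pi / 2 * t) := by
    have h := hG2 (1 / 2 - s) (by simp; linarith) (by simp; linarith)
    have e : |((1 : ℂ) / 2 - s).im| = t := by simp [ht]
    rwa [e] at h
  have b4 : ‖(2 : ℂ) ^ (6 * s + 1)‖ ≤ 2 := by
    have h := Complex.norm_cpow_eq_rpow_re_of_pos (x := 2) two_pos (6 * s + 1)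
    rw [Complex.ofReal_ofNat] at h
    rw [h]
    calc (2 : ℝ) ^ (6 * s + 1).re ≤ 2 ^ (1 : ℝ) :=
          Real.rpow_le_rpow_of_exponent_le one_le_two (by simp; linarith)
      _ = 2 := Real.rpow_one 2
  have b5 : ‖(q : ℂ) ^ (-4 * s)‖ ≤ Real.exp (|Real.log q| * (4 * δ)) := by
    rw [Complex.norm_cpow_eq_rpow_re_of_pos hq, Real.rpow_def_of_pos hq]
    refine Real.exp_le_exp.2 ((le_abs_self _).trans ?_)
    have e : (-4 * s).re = -4 * s.re := by simp
    rw [abs_mul, e, abs_mul, abs_neg, abs_of_pos (by norm_num : (0 : ℝ) < 4)]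
    gcongr
  have h4 : Real.exp (A * t) * Real.exp (-(Real.pi * t)) * Real.exp (Real.pi / 2 * t) =
      Real.exp (-((Real.pi / 2 - A) * t)) := by
    rw [← Real.exp_add, ← Real.exp_add]
    ring_nf
  have h5 := hE t (abs_nonneg _)
  rw [hankelMellinIntegrand, div_eq_mul_inv, norm_mul, norm_mul, norm_mul, norm_mul,
    ← sq_abs s.im, le_div_iff₀ (by positivity)]
  calc _ ≤ C * Real.exp (|P| * δ) * Real.exp (A * t) *
        (K1 * (2 * (1 + t) * Real.exp (-(Real.pi * t))) * (K2 * Real.exp (Real.pi / 2 * t))) *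
        2 * Real.exp (|Real.log q| * (4 * δ)) * t ^ 2 := by gcongr
    _ = C * Real.exp (|P| * δ) * K1 * K2 * 2 * Real.exp (|Real.log q| * (4 * δ)) * 2 *
        ((1 + t) * t ^ 2 *
          (Real.exp (A * t) * Real.exp (-(Real.pi * t)) * Real.exp (Real.pi / 2 * t))) := by ring
    _ ≤ C * Real.exp (|P| * δ) * K1 * K2 * 2 * Real.exp (|Real.log q| * (4 * δ)) * 2 *
        ((1 + t) ^ 4 * Real.exp (-((Real.pi / 2 - A) * t))) := by
        rw [h4]
        have : (1 + t) * t ^ 2 ≤ (1 + t) ^ 4 := by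
          have ht0 : 0 ≤ t := abs_nonneg _
          nlinarith [pow_nonneg ht0 2, pow_nonneg ht0 3, pow_nonneg ht0 4]
        gcongr
    _ ≤ _ := by gcongr

section Hankel

variable {hbar : ℂ → ℂ} {δ C P A : ℝ}

lemma continuous_Gamma_mul_vertical (hδ0 : 0 < δ)
    (hbar_regular : DifferentiableOn ℂ hbar {s : ℂ | -δ ≤ s.re}) :
    Continuous fun w : ℝ => Complex.Gamma (-((-δ : ℝ) + w * Complex.I)) *
      hbar ((-δ : ℝ) + w * Complex.I) := by
  refine Continuous.mul ?_
    (hbar_regular.continuousOn.comp_continuous (by fun_prop) fun w => by simp)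
  refine continuous_iff_continuousAt.2 fun w => ContinuousAt.comp
    (f := fun w : ℝ => -(((-δ : ℝ) : ℂ) + w * Complex.I))
    (Complex.differentiableAt_Gamma _ fun m h => ?_).continuousAt (by fun_prop)
  have h1 := congrArg Complex.re h
  have : (0 : ℝ) ≤ m := by positivity
  simp at h1
  linarith

lemma integrable_norm_Gamma_mul_vertical (hδ0 : 0 < δ) (hδ : δ < 1 / 2)
    (hbar_regular : DifferentiableOn ℂ hbar {s : ℂ | -δ ≤ s.re}) (hA : A < Real.pi / 2)
    (hbar_growth : ∀ s : ℂ, -δ ≤ s.re → ‖hbar s‖ ≤ C * Real.exp (P * s.re + A * |s.im|)) :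
    Integrable fun w : ℝ => ‖Complex.Gamma (-((-δ : ℝ) + w * Complex.I)) *
      hbar ((-δ : ℝ) + w * Complex.I)‖ * (1 + |w|) := by
  obtain ⟨K, hK, hG⟩ := exists_Gamma_mul_exp_le (a := δ) (b := δ) hδ0 (by linarith) hA
  have hC : 0 ≤ C := by
    have := (norm_nonneg _).trans (hbar_growth 0 (by simpa using hδ0.le))
    simpa using this
  refine Integrable.mono' (integrable_inv_one_add_sq.const_mul (C * Real.exp (P * -δ) * K))
    ((continuous_Gamma_mul_vertical hδ0 hbar_regular).norm.mul
      (by fun_prop)).aestronglyMeasurable (Eventually.of_forall fun w => ?_)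
  have h1 := hG (-((-δ : ℝ) + w * Complex.I)) (by simp) (by simp)
  have e1 : |(-(((-δ : ℝ) : ℂ) + w * Complex.I)).im| = |w| := by simp
  rw [e1] at h1
  have h2 := hbar_growth ((-δ : ℝ) + w * Complex.I) (by simp)
  have e2 : (((-δ : ℝ) : ℂ) + w * Complex.I).re = -δ := by simp
  have e3 : (((-δ : ℝ) : ℂ) + w * Complex.I).im = w := by simp
  rw [e2, e3, Real.exp_add, ← mul_assoc] at h2
  have h4 : 1 + w ^ 2 ≤ (1 + |w|) ^ 2 := by
    rw [← sq_abs]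
    nlinarith [abs_nonneg w]
  rw [Real.norm_of_nonneg (by positivity), norm_mul, ← div_eq_mul_inv, le_div_iff₀ (by positivity)]
  calc _ ≤ ‖Complex.Gamma (-((-δ : ℝ) + w * Complex.I))‖ *
        (C * Real.exp (P * -δ) * Real.exp (A * |w|)) * (1 + |w|) * (1 + |w|) ^ 2 := by gcongr
    _ = C * Real.exp (P * -δ) * (‖Complex.Gamma (-((-δ : ℝ) + w * Complex.I))‖ *
        Real.exp (A * |w|) * (1 + |w|) ^ 3) := by ring
    _ ≤ _ := by gcongr

lemma ofReal_pow_four_cpow {x : ℝ} (hx : 0 < x) (s : ℂ) :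
    ((x ^ 4 : ℝ) : ℂ) ^ s = (x : ℂ) ^ (4 * s) := by
  rw [ofReal_cpow_eq_exp (by positivity), ofReal_cpow_eq_exp hx, Real.log_pow]
  congr 1
  push_cast
  ring

lemma measurable_hankelKernel_integrand (q σ : ℝ) :
    Measurable (Function.uncurry fun x w : ℝ => (besselJ0 (q * x) : ℂ) *
      (x : ℂ) ^ (4 * ((σ : ℂ) + w * Complex.I)) * x) := by
  have m1 : Measurable fun z : ℝ × ℝ => (z.1 : ℂ) := Complex.measurable_ofReal.comp measurable_fst
  have m2 : Measurable fun z : ℝ × ℝ => 4 * ((σ : ℂ) + z.2 * Complex.I) :=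
    (by fun_prop : Continuous fun z : ℝ × ℝ => 4 * ((σ : ℂ) + z.2 * Complex.I)).measurable
  have m3 : Measurable fun x => besselJ0 (q * x) :=
    (continuous_besselJ0.comp (continuous_const_mul q)).measurable
  exact ((Complex.measurable_ofReal.comp (m3.comp measurable_fst)).mul (m1.pow m2)).mul m1

lemma stronglyMeasurable_hankelKernel (q σ : ℝ) {R : ℝ} (hR : 0 ≤ R) :
    StronglyMeasurable fun w : ℝ => hankelKernel q R (σ + w * Complex.I) := by
  simp only [hankelKernel, intervalIntegral.integral_of_le hR]
  exact (measurable_hankelKernel_integrand q σ).stronglyMeasurable.integral_prod_left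

/-- Inserting the Mellin–Barnes integral of `h` into the truncated Hankel transform and exchanging
the integrations. -/
lemma integral_hankel_truncated {h : ℂ → ℂ}
    (h_mellin : ∀ x : ℝ, 0 < x → ∫ w : ℝ, Complex.Gamma (-((-δ : ℝ) + w * Complex.I)) *
      (hbar ((-δ : ℝ) + w * Complex.I) * (x : ℂ) ^ (((-δ : ℝ) : ℂ) + w * Complex.I)) =
      2 * Real.pi * h x)
    (hδ0 : 0 < δ) (hδ : δ < 1 / 2)
    (hbar_regular : DifferentiableOn ℂ hbar {s : ℂ | -δ ≤ s.re}) (hA : A < Real.pi / 2)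
    (hbar_growth : ∀ s : ℂ, -δ ≤ s.re → ‖hbar s‖ ≤ C * Real.exp (P * s.re + A * |s.im|))
    {q R : ℝ} (hR : 0 < R) :
    2 * (Real.pi : ℂ) * ∫ x in (0 : ℝ)..R, (besselJ0 (q * x) : ℂ) * h ((x : ℂ) ^ 4) * x =
      ∫ w : ℝ, Complex.Gamma (-((-δ : ℝ) + w * Complex.I)) * hbar ((-δ : ℝ) + w * Complex.I) *
        hankelKernel q R ((-δ : ℝ) + w * Complex.I) := by
  set g : ℝ → ℂ := fun w => Complex.Gamma (-((-δ : ℝ) + w * Complex.I)) *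
    hbar ((-δ : ℝ) + w * Complex.I) with hg
  have hgc : Continuous g := continuous_Gamma_mul_vertical hδ0 hbar_regular
  have hgi : Integrable g := by
    refine Integrable.mono' (integrable_norm_Gamma_mul_vertical hδ0 hδ hbar_regular hA hbar_growth)
      hgc.aestronglyMeasurable (Eventually.of_forall fun w => ?_)
    exact le_mul_of_one_le_right (norm_nonneg _) (by linarith [abs_nonneg w])
  have hJ0 : Continuous fun x => besselJ0 (q * x) :=
    continuous_besselJ0.comp (continuous_const_mul q)
  set k : ℝ → ℝ → ℂ := fun x w => g w * ((besselJ0 (q * x) : ℂ) *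
    (x : ℂ) ^ (4 * (((-δ : ℝ) : ℂ) + w * Complex.I)) * x) with hk
  have hmeas : Measurable (Function.uncurry k) :=
    (hgc.measurable.comp measurable_snd).mul (measurable_hankelKernel_integrand q (-δ))
  have hxi : Integrable (fun x : ℝ => (besselJ0 (q * x) : ℂ) *
      (x : ℂ) ^ (4 * ((-δ : ℝ) : ℂ)) * x) (volume.restrict (Set.Ioc 0 R)) :=
    (intervalIntegrable_iff_integrableOn_Ioc_of_le hR.le).1
      (intervalIntegrable_mul_cpow_mul hJ0 (by simp; linarith) R)
  have hint : Integrable (Function.uncurry k) ((volume.restrict (Set.Ioc 0 R)).prod volume) := by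
    refine Integrable.mono' (hxi.norm.mul_prod hgi.norm) hmeas.aestronglyMeasurable ?_
    filter_upwards [Measure.quasiMeasurePreserving_fst.ae (ae_restrict_mem measurableSet_Ioc)]
      with z hz
    have hz0 : 0 < z.1 := hz.1
    have e : ‖(z.1 : ℂ) ^ (4 * (((-δ : ℝ) : ℂ) + z.2 * Complex.I))‖ =
        ‖(z.1 : ℂ) ^ (4 * ((-δ : ℝ) : ℂ))‖ := by
      rw [Complex.norm_cpow_eq_rpow_re_of_pos hz0, Complex.norm_cpow_eq_rpow_re_of_pos hz0]
      simp
    simp only [Function.uncurry, hk]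
    rw [norm_mul, norm_mul _ (z.1 : ℂ), norm_mul _ (z.1 : ℂ), norm_mul (besselJ0 (q * z.1) : ℂ),
      norm_mul (besselJ0 (q * z.1) : ℂ), e, mul_comm]
  have hswap := integral_integral_swap hint
  rw [← intervalIntegral.integral_const_mul, intervalIntegral.integral_of_le hR.le]
  have hleft : ∀ x ∈ Set.Ioc 0 R, ∫ w, k x w =
      2 * Real.pi * ((besselJ0 (q * x) : ℂ) * h ((x : ℂ) ^ 4) * x) := by
    intro x hx
    have hx0 : 0 < x := hx.1
    have hm := h_mellin (x ^ 4) (by positivity)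
    have e : ∀ w, k x w = (besselJ0 (q * x) : ℂ) * x *
        (Complex.Gamma (-((-δ : ℝ) + w * Complex.I)) * (hbar ((-δ : ℝ) + w * Complex.I) *
          ((x ^ 4 : ℝ) : ℂ) ^ (((-δ : ℝ) : ℂ) + w * Complex.I))) := fun w => by
      rw [ofReal_pow_four_cpow hx0]
      simp only [hk, hg]
      ring
    simp only [e]
    rw [integral_const_mul, hm]
    push_cast
    ring
  rw [← setIntegral_congr_fun measurableSet_Ioc hleft, hswap]
  refine integral_congr_ae (Eventually.of_forall fun w => ?_)
  simp only [hk, hankelKernel]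
  rw [integral_const_mul, intervalIntegral.integral_of_le hR.le]

end Hankel

theorem theorem2
    -- `hbar s` is the interpolation of the signed Taylor coefficients of `h` at `0`
    (h : ℂ → ℂ) (hbar : ℂ → ℂ) (d δ C P A : ℝ)
    -- `h` is regular on (a neighbourhood of) the half-line `[0, ∞)`, with Taylor series at `0`
    (h_regular : ∀ x : ℝ, 0 ≤ x → AnalyticAt ℂ h (x : ℂ))
    (h_taylor : ∀ᶠ z : ℂ in 𝓝 0,
      HasSum (fun m : ℕ => hbar (m : ℂ) / (m ! : ℂ) * (-z) ^ m) (h z))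
    -- decay of `h` at infinity
    (hd : 1 / 8 < d)
    (h_decay : (fun x : ℝ => h (x : ℂ)) =O[atTop] (fun x : ℝ => x ^ (-d)))
    -- `hbar` is regular on the half-plane `Re s ≥ -δ` and satisfies the growth condition
    (hδ : 1 / 8 < δ) (hδ' : δ < 1 / 2)
    (hbar_regular : DifferentiableOn ℂ hbar {s : ℂ | -δ ≤ s.re})
    (hA : A < Real.pi / 2)
    (hbar_growth : ∀ s : ℂ, -δ ≤ s.re →
      ‖hbar s‖ < C * Real.exp (P * s.re + A * |s.im|))
    (q : ℝ) (hq : 0 < q)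
    -- the contour lies in the half-plane on which `hbar` is given
    (α : ℝ) (hα : -δ ≤ α) (hα' : α < 0) :
    VerticalIntegrable α (hankelMellinIntegrand hbar q) ∧
      HasHankelTransform (fun x : ℝ => h ((x : ℂ) ^ 4)) q
        (1 / ((q : ℂ) ^ 2 * (Real.sqrt Real.pi : ℂ) * Complex.I) *
          verticalIntegral α (hankelMellinIntegrand hbar q)) := by
  have hδ0 : 0 < δ := by linarith
  have hgrow : ∀ s : ℂ, -δ ≤ s.re → ‖hbar s‖ ≤ C * Real.exp (P * s.re + A * |s.im|) :=
    fun s hs => (hbar_growth s hs).le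
  have hdiff := differentiableOn_hankelMellinIntegrand hδ' hbar_regular hq
  obtain ⟨K, hK⟩ := exists_norm_hankelMellinIntegrand_le hδ' hδ0 hα' hA hgrow hq
  have hcont : ContinuousOn (hankelMellinIntegrand hbar q) {s | -δ ≤ s.re ∧ s.re ≤ α} :=
    hdiff.continuousOn.mono fun s hs => hs.1
  have hshift : ∫ w : ℝ, hankelMellinIntegrand hbar q ((-δ : ℝ) + w * Complex.I) =
      ∫ w : ℝ, hankelMellinIntegrand hbar q (α + w * Complex.I) := by
    rcases hα.eq_or_lt with rfl | hlt
    · rfl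
    · exact integral_vertical_eq hlt hcont (hdiff.mono fun s hs => hs.1.le) hK
  refine ⟨integrable_of_norm_le_div_sq (continuous_vertical hcont hα le_rfl) (K := K)
    fun w hw => ?_, fun R hR => ?_, ?_⟩
  · simpa using hK (α + w * Complex.I) (by simpa using hα) (by simp) (by simpa using hw)
  · refine ContinuousOn.intervalIntegrable fun x hx => ?_
    rw [Set.uIcc_of_le hR] at hx
    have h1 : ContinuousAt h ((x : ℂ) ^ 4) := by
      have := (h_regular (x ^ 4) (by positivity)).continuousAt
      rwa [Complex.ofReal_pow] at this
    have h2 : ContinuousAt (fun x : ℝ => h ((x : ℂ) ^ 4)) x :=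
      ContinuousAt.comp (f := fun x : ℝ => (x : ℂ) ^ 4) h1 (by fun_prop)
    have h3 : Continuous fun x : ℝ => (besselJ0 (q * x) : ℂ) :=
      Complex.continuous_ofReal.comp (continuous_besselJ0.comp (continuous_const_mul q))
    exact ((h3.continuousAt.mul h2).mul
      Complex.continuous_ofReal.continuousAt).continuousWithinAt
  · have h_mellin := fun x (hx : (0 : ℝ) < x) => integral_Gamma_mul_cpow_eq h_regular h_taylor hδ0
      hδ' hbar_regular hA hgrow hx
    set g : ℝ → ℂ := fun w => Complex.Gamma (-((-δ : ℝ) + w * Complex.I)) *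
      hbar ((-δ : ℝ) + w * Complex.I) with hg
    obtain ⟨M, hM, hbound⟩ := exists_norm_hankelKernel_le hq hδ hδ'
    have hlim : Tendsto (fun R : ℝ => ∫ w : ℝ, g w * hankelKernel q R ((-δ : ℝ) + w * Complex.I))
        atTop (𝓝 (∫ w : ℝ, 2 * Real.pi * (1 / ((q : ℂ) ^ 2 * (Real.sqrt Real.pi : ℂ)) *
          hankelMellinIntegrand hbar q ((-δ : ℝ) + w * Complex.I)))) := by
      refine tendsto_integral_filter_of_dominated_convergence
        (fun w => ‖g w‖ * (1 + |w|) * M) ?_ ?_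
        ((integrable_norm_Gamma_mul_vertical hδ0 hδ' hbar_regular hA hgrow).mul_const M) ?_
      · filter_upwards [eventually_ge_atTop 0] with R hR
        exact ((continuous_Gamma_mul_vertical hδ0 hbar_regular).aestronglyMeasurable).mul
          (stronglyMeasurable_hankelKernel q (-δ) hR).aestronglyMeasurable
      · filter_upwards [hbound] with R hR
        refine Eventually.of_forall fun w => ?_
        rw [norm_mul, mul_assoc, mul_comm (1 + |w|)]
        exact mul_le_mul_of_nonneg_left (hR w) (norm_nonneg _)
      · refine Eventually.of_forall fun w => ?_
        have hre : (((-δ : ℝ) : ℂ) + w * Complex.I).re = -δ := by simp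
        rw [← Gamma_mul_mellin_eq_hankelMellinIntegrand hbar hq (by rw [hre]; linarith)
          (by rw [hre]; linarith)]
        exact (tendsto_hankelKernel hq (by rw [hre]; linarith)
          (by rw [hre]; linarith)).const_mul _
    rw [integral_const_mul, integral_const_mul, hshift] at hlim
    have hpi : (2 * (Real.pi : ℂ)) ≠ 0 := by simp [Real.pi_ne_zero]
    have hlim2 := hlim.const_mul (2 * (Real.pi : ℂ))⁻¹
    rw [inv_mul_cancel_left₀ hpi] at hlim2
    have e : 1 / ((q : ℂ) ^ 2 * (Real.sqrt Real.pi : ℂ) * Complex.I) *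
        verticalIntegral α (hankelMellinIntegrand hbar q) =
        1 / ((q : ℂ) ^ 2 * (Real.sqrt Real.pi : ℂ)) *
          ∫ w : ℝ, hankelMellinIntegrand hbar q (α + w * Complex.I) := by
      rw [verticalIntegral, ← mul_assoc]
      congr 1
      rw [← div_div, div_mul_cancel₀ _ Complex.I_ne_zero]
    rw [e]
    refine hlim2.congr' ?_
    filter_upwards [eventually_gt_atTop 0] with R hR
    rw [← integral_hankel_truncated h_mellin hδ0 hδ' hbar_regular hA hgrow hR,
      inv_mul_cancel_left₀ hpi]
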